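/- **Setting.** Let $K,n$ be natural numbers and $\mathscr S=\{1,\dots,K\}$. For each $k\in\mathscr S$ let $A_k\in\mathbb R^{n\times n}$ be negative definite (that is, $x^{\top}A_kx<0$ for all $x\ne 0$; $A_k$ need not be symmetric), $b_k\in\mathbb R^n$, and let $f_k$ be a probability distribution on $\mathbb R^n$ with zero mean and finite second moment. Let $P=[p_{i,j}]$ be a stochastic $K\times K$ matrix. On a probability space let $(s_t)_{t\ge 0}$ be a Markov chain on $\mathscr S$ with transition matrix $P$ and arbitrary initial distribution, and let $(w_t)_{t\ge1}$ be random vectors in $\mathbb R^n$ which, conditionally on the state sequence, are independent with $w_t\sim f_{s_t}$. The input $x_t\in\mathbb R^n$ at stage $t\ge 1$ is chosen after $s_{t-1}$ and before $s_t$ is observed, and the output is $y_t=A_{s_t}x_t+b_{s_t}+w_t$. The stage cost is $\mathbb E(-x_t^{\top}y_t\mid s_{t-1},x_t)$; given $s_{t-1}=i$, its unique minimizer is the optimal input $$x_i^*=-\Big(\sum_j p_{i,j}(A_j+A_j^{\top})\Big)^{-1}\sum_j p_{i,j}b_j .$$ Let $\Pi\subset\mathbb R^n$ be a convex compact set with $x_i^*\in\Pi$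 for all $i\in\mathscr S$, and let $(\cdot)_\Pi$ be the Euclidean projection onto $\Pi$. **The MSPSA policy.** For each $i\in\mathscr S$ fix reals $\gamma_i,\gamma_i'>0$, integers $N_i,N_i'\ge0$ and an initial estimate $\hat x_{i,1}\in\Pi$; put $a_{i,k}=\gamma_i/(N_i+k)$ and $c_{i,k}=\gamma_i'/(N_i'+k)^{1/4}$ for $k\ge1$. Let $\nu$ be a probability distribution on $\mathbb R$, symmetric around $0$, such that a random variable $Z\sim\nu$ satisfies $|Z|\le\xi_1$ almost surely and $\mathbb E(1/Z^2)\le\xi_2$ for some constants $\xi_1,\xi_2$ (in particular $Z\neq0$ almost surely). Let $(\Delta^{(t)})_{t\ge1}$ be random vectors in $\mathbb R^n$ whose entries, over all $t$, are independent with distribution $\nu$, the whole family being independent of $((s_t)_{t\ge0},(w_t)_{t\ge1})$. Start with $t_i=0$ and $e_i=0$ for every $i$. At stage $t=1,2,\dots$, with $i=s_{t-1}$: * if $e_i=0$: replace $t_i$ by $t_i+1$, set $\Delta_{i,t_i}=\Delta^{(t)}$, use the input $x_t=\hat x_{i,t_i}+c_{i,t_i}\Delta_{i,t_i}$, put $d^+_{i,t_i}=-x_t^{\top}y_t$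 and set $e_i=1$; * if $e_i=1$: use the input $x_t=\hat x_{i,t_i}-c_{i,t_i}\Delta_{i,t_i}$, put $d^-_{i,t_i}=-x_t^{\top}y_t$, set $e_i=0$, and update $$\hat x_{i,t_i+1}=\Big(\hat x_{i,t_i}-a_{i,t_i}\frac{d^+_{i,t_i}-d^-_{i,t_i}}{c_{i,t_i}}\bar\Delta_{i,t_i}\Big)_{\Pi},$$ where $\bar\Delta_{i,k}$ is the vector of the reciprocals of the entries of $\Delta_{i,k}$. **Theorem.** The input $x_T$ of the MSPSA policy for revenue maximization converges to the optimal input $x^*_{s_{T-1}}$ almost surely and in mean square: $$\Pr\Big(\lim_{T\to\infty}\|x_T-x^*_{s_{T-1}}\|_2^2=0\Big)=1,$$ and $\mathbb E\big(\|x_T-x^*_{s_{T-1}}\|_2^2\big)<\infty$ for every $T\ge1$ with $$\lim_{T\to\infty}\mathbb E\big(\|x_T-x^*_{s_{T-1}}\|_2^2\big)=0 .$$ -/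

import Mathlib

open MeasureTheory ProbabilityTheory Filter Topology
open scoped RealInnerProductSpace

noncomputable section

namespace MarkovJump

/-- The Euclidean space of inputs and outputs. -/
abbrev Vec (n : ℕ) : Type := EuclideanSpace ℝ (Fin n)

/-- Negative definiteness of a real square matrix that need not be symmetric. -/
def NegDef {n : ℕ} (A : Matrix (Fin n) (Fin n) ℝ) : Prop :=
  ∀ x : Vec n, x ≠ 0 → ⟪x, Matrix.toEuclideanLin A x⟫ < 0

/-- The parameters of a Markov jump affine model with `K` states and equal input and output
dimension `n`: the affine maps `x ↦ A k x + b k`, the transition matrix and the noise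
distributions. -/
structure Model (K n : ℕ) where
  A : Fin K → Matrix (Fin n) (Fin n) ℝ
  b : Fin K → Vec n
  P : Matrix (Fin K) (Fin K) ℝ
  f : Fin K → Measure (Vec n)

/-- The standing assumptions on the parameters: negative definite system matrices, a stochastic
transition matrix, and noise distributions with zero mean and finite variance. -/
structure Model.IsAdmissible {K n : ℕ} (M : Model K n) : Prop where
  negDef : ∀ k, NegDef (M.A k)
  stochastic : M.P ∈ Matrix.rowStochastic ℝ (Fin K)
  isProb : ∀ k, IsProbabilityMeasure (M.f k)
  memLp : ∀ k, MemLp (fun w : Vec n => w) 2 (M.f k)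
  mean_zero : ∀ k, ∫ w, w ∂(M.f k) = 0

/-- The output of the system in state `k` for the input `x` and the noise `w`. -/
def Model.output {K n : ℕ} (M : Model K n) (k : Fin K) (x w : Vec n) : Vec n :=
  Matrix.toEuclideanLin (M.A k) x + M.b k + w

/-- The stage cost of revenue maximization: the expectation of `- x ⬝ y` for the input `x`, given
that the previous state is `i`. -/
def Model.stageCost {K n : ℕ} (M : Model K n) (i : Fin K) (x : Vec n) : ℝ :=
  ∑ j, M.P i j * ∫ w, -⟪x, M.output j x w⟫ ∂(M.f j)

/-- The optimal input after the state `i` under known model. -/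
def Model.optimalInput {K n : ℕ} (M : Model K n) (i : Fin K) : Vec n :=
  -Matrix.toEuclideanLin (∑ j, M.P i j • (M.A j + (M.A j).transpose))⁻¹ (∑ j, M.P i j • M.b j)

/-- The processes `s` (states) and `w` (noise) on `(Ω, μ)` follow the model. Here `s t` is the
state at time `t`, while `w t` is the noise of stage `t + 1`, which produces the output at time
`t + 1`. The last field says that `s` is a Markov chain with transition matrix `P` (and arbitrary
initial distribution), and that, given the states, the noise vectors are independent and the noise
of stage `t + 1` is distributed according to `f (s (t + 1))`. -/
structure Model.IsRealizedBy {K n : ℕ} (M : Model K n) {Ω : Type*} [MeasurableSpace Ω]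
    (μ : Measure Ω) (s : ℕ → Ω → Fin K) (w : ℕ → Ω → Vec n) : Prop where
  measurable_state : ∀ t, Measurable (s t)
  measurable_noise : ∀ t, Measurable (w t)
  law : ∀ (T : ℕ) (σ : ℕ → Fin K) (B : ℕ → Set (Vec n)), (∀ t, MeasurableSet (B t)) →
    μ {ω | (∀ t ≤ T, s t ω = σ t) ∧ ∀ t < T, w t ω ∈ B t} =
      μ {ω | s 0 ω = σ 0} *
        ∏ t ∈ Finset.range T,
          (ENNReal.ofReal (M.P (σ t) (σ (t + 1))) * M.f (σ (t + 1)) (B t))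

/-- Admissible distributions for the entries of the perturbation vectors: symmetric around zero,
bounded by `ξ₁`, and with `𝔼 (1 / Δ²) ≤ ξ₂`. The last expectation is taken in `[0, ∞]`, where
`1 / 0 = ∞`, so that it forces `Δ ≠ 0` almost surely. -/
structure IsPerturbationLaw (ν : Measure ℝ) (ξ₁ ξ₂ : ℝ) : Prop where
  isProb : IsProbabilityMeasure ν
  symm : ν.map (fun z => -z) = ν
  bounded : ∀ᵐ z ∂ν, |z| ≤ ξ₁
  inv_sq : ∫⁻ z, (ENNReal.ofReal (z ^ 2))⁻¹ ∂ν ≤ ENNReal.ofReal ξ₂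

/-- The perturbation vectors `D t` (the fresh vector that is available to the policy at stage
`t + 1`): all entries, over all stages, are independent with law `ν`, and the whole family is
independent of the states and the noise. -/
structure IsPerturbation {K n : ℕ} {Ω : Type*} [MeasurableSpace Ω] (μ : Measure Ω) (ν : Measure ℝ)
    (s : ℕ → Ω → Fin K) (w D : ℕ → Ω → Vec n) : Prop where
  measurable : ∀ t, Measurable (D t)
  law : ∀ t j, μ.map (fun ω => D t ω j) = ν
  indep_entries : iIndepFun (fun (p : ℕ × Fin n) (ω : Ω) => D p.1 ω p.2) μ
  indep_model : IndepFun (fun ω t => D t ω) (fun ω => (fun t => s t ω, fun t => w t ω)) μ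

/-- Euclidean projection onto a set `S`: a point of `S` nearest to `x` (for nonempty compact convex
`S` it exists and is unique). -/
def proj {n : ℕ} (S : Set (Vec n)) (x : Vec n) : Vec n :=
  open Classical in
  if h : ∃ y ∈ S, ∀ z ∈ S, ‖x - y‖ ≤ ‖x - z‖ then h.choose else x

/-- The tuning parameters of the MSPSA policy: the feasible set `Π`, the initial estimates
`x̂_{i,1}`, and the constants of the step sizes and of the perturbation gains. -/
structure Params (K n : ℕ) where
  feasible : Set (Vec n)
  init : Fin K → Vec n
  γ : Fin K → ℝ
  γ' : Fin K → ℝ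
  N : Fin K → ℕ
  N' : Fin K → ℕ

/-- The requirements of the policy on its tuning parameters. -/
structure Params.IsAdmissible {K n : ℕ} (p : Params K n) : Prop where
  convex : Convex ℝ p.feasible
  compact : IsCompact p.feasible
  init_mem : ∀ i, p.init i ∈ p.feasible
  γ_pos : ∀ i, 0 < p.γ i
  γ'_pos : ∀ i, 0 < p.γ' i

/-- The step size `a_k = γ_i / (N_i + k)` of state `i`. -/
def Params.a {K n : ℕ} (p : Params K n) (i : Fin K) (k : ℕ) : ℝ :=
  p.γ i / ((p.N i : ℝ) + k)

/-- The perturbation gain `c_k = γ'_i / (N'_i + k) ^ (1/4)` of state `i`. -/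
def Params.c {K n : ℕ} (p : Params K n) (i : Fin K) (k : ℕ) : ℝ :=
  p.γ' i / ((p.N' i : ℝ) + k) ^ (1 / 4 : ℝ)

/-- The memory of the MSPSA policy; every entry is indexed by the state `i` of the chain:
the current estimate, the counter `t_i`, the flag `e_i` (`true` stands for `e_i = 1`), the last
perturbation vector `Δ_{t_i}` and the last observed cost `d⁺_{i,t_i}`. -/
structure Memory (K n : ℕ) where
  est : Fin K → Vec n
  count : Fin K → ℕ
  flag : Fin K → Bool
  pert : Fin K → Vec n
  dplus : Fin K → ℝ

/-- The initial memory: `t_i = 0` and `e_i = 0` for all `i`. The entries `pert` and `dplus` are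
overwritten before they are used. -/
def Params.start {K n : ℕ} (p : Params K n) : Memory K n where
  est := p.init
  count := fun _ => 0
  flag := fun _ => false
  pert := fun _ => 0
  dplus := fun _ => 0

/-- The input chosen by MSPSA after observing the state `i`, where `Δ` is a fresh perturbation
vector (used only if `e_i = 0`). -/
def Params.input {K n : ℕ} (p : Params K n) (m : Memory K n) (i : Fin K) (Δ : Vec n) : Vec n :=
  if m.flag i = false then m.est i + p.c i (m.count i + 1) • Δ
  else m.est i - p.c i (m.count i) • m.pert i

/-- The memory of MSPSA for revenue maximization after a stage at which the state `i` was observed,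
the fresh perturbation vector was `Δ`, and the output `y` resulted. -/
def Params.update {K n : ℕ} (p : Params K n) (m : Memory K n) (i : Fin K) (Δ y : Vec n) :
    Memory K n :=
  let d : ℝ := -⟪p.input m i Δ, y⟫
  if m.flag i = false then
    { m with
      count := Function.update m.count i (m.count i + 1)
      flag := Function.update m.flag i true
      pert := Function.update m.pert i Δ
      dplus := Function.update m.dplus i d }
  else
    { m with
      est := Function.update m.est i
        (proj p.feasible
          (m.est i - (p.a i (m.count i) * ((m.dplus i - d) / p.c i (m.count i))) •
            WithLp.toLp 2 (fun j => 1 / m.pert i j)))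
      flag := Function.update m.flag i false }

/-- The memory of MSPSA after `t` stages, when it is run on the system `M` along the state path `s`,
the noise path `w` and the perturbations `D`. -/
def Params.run {K n : ℕ} (p : Params K n) (M : Model K n) (s : ℕ → Fin K) (w D : ℕ → Vec n) :
    ℕ → Memory K n
  | 0 => p.start
  | t + 1 =>
    let m := p.run M s w D t
    p.update m (s t) (D t) (M.output (s (t + 1)) (p.input m (s t) (D t)) (w t))

/-- The input `x_T` of MSPSA at the stage `T = t + 1`, which is chosen after observing the state
`s_{T-1} = s t`. -/
def Params.inputAt {K n : ℕ} (p : Params K n) (M : Model K n) (s : ℕ → Fin K) (w D : ℕ → Vec n)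
    (t : ℕ) : Vec n :=
  p.input (p.run M s w D t) (s t) (D t)

/-- `proj` is a nearest-point map on nonempty compact sets. -/
theorem proj_spec {n : ℕ} {S : Set (Vec n)} (hS : IsCompact S) (hne : S.Nonempty) (x : Vec n) :
    proj S x ∈ S ∧ ∀ z ∈ S, ‖x - proj S x‖ ≤ ‖x - z‖ := by
  have h : ∃ y ∈ S, ∀ z ∈ S, ‖x - y‖ ≤ ‖x - z‖ := by
    obtain ⟨y, hy, hmin⟩ := hS.exists_isMinOn hne
      (f := fun y => ‖x - y‖) (by fun_prop)
    exact ⟨y, hy, fun z hz => hmin hz⟩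
  unfold proj
  rw [dif_pos h]
  exact h.choose_spec

theorem Model.stageCost_eq {K n : ℕ} {M : Model K n} (hM : M.IsAdmissible) (i : Fin K) (x : Vec n) :
    M.stageCost i x =
      -⟪x, Matrix.toEuclideanLin (∑ j, M.P i j • M.A j) x⟫ - ⟪x, ∑ j, M.P i j • M.b j⟫ := by
  have h1 : ∀ j, ∫ w, -⟪x, M.output j x w⟫ ∂(M.f j) =
      -⟪x, Matrix.toEuclideanLin (M.A j) x⟫ - ⟪x, M.b j⟫ := by
    intro j
    have := hM.isProb j
    have hi : Integrable (fun w : Vec n => w) (M.f j) := (hM.memLp j).integrable (by norm_num)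
    have h2 : ∫ w, ⟪x, w⟫ ∂(M.f j) = 0 := by
      rw [integral_inner hi, hM.mean_zero j, inner_zero_right]
    simp only [Model.output, inner_add_right]
    rw [integral_neg, integral_add (integrable_const _) (hi.const_inner x), h2]
    simp
    ring
  unfold Model.stageCost
  simp only [h1, map_sum, map_smul, LinearMap.sum_apply, LinearMap.smul_apply, inner_sum,
    inner_smul_right]
  rw [← Finset.sum_neg_distrib, ← Finset.sum_sub_distrib]
  exact Finset.sum_congr rfl fun j _ => by ring

theorem inner_transpose {n : ℕ} (A : Matrix (Fin n) (Fin n) ℝ) (x y : Vec n) :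
    ⟪x, Matrix.toEuclideanLin A.transpose y⟫ = ⟪Matrix.toEuclideanLin A x, y⟫ := by
  rw [← LinearMap.adjoint_inner_right, ← Matrix.toEuclideanLin_conjTranspose_eq_adjoint,
    Matrix.conjTranspose_eq_transpose_of_trivial]

/-- `optimalInput` is the unique minimizer of the stage cost. -/
theorem Model.stageCost_optimalInput_lt {K n : ℕ} {M : Model K n} (hM : M.IsAdmissible) (i : Fin K)
    (x : Vec n) (hx : x ≠ M.optimalInput i) :
    M.stageCost i (M.optimalInput i) < M.stageCost i x := by
  set Q : Matrix (Fin n) (Fin n) ℝ := ∑ j, M.P i j • M.A j with hQ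
  set β : Vec n := ∑ j, M.P i j • M.b j with hβ
  have hH : (∑ j, M.P i j • (M.A j + (M.A j).transpose)) = Q + Q.transpose := by
    simp [hQ, smul_add, Finset.sum_add_distrib, Matrix.transpose_sum]
  have hP := Matrix.mem_rowStochastic_iff_sum.1 hM.stochastic
  have hneg : ∀ v : Vec n, v ≠ 0 → ⟪v, Matrix.toEuclideanLin Q v⟫ < 0 := by
    intro v hv
    have e : ⟪v, Matrix.toEuclideanLin Q v⟫
        = ∑ j, M.P i j * ⟪v, Matrix.toEuclideanLin (M.A j) v⟫ := by
      simp only [hQ, map_sum, map_smul, LinearMap.sum_apply, LinearMap.smul_apply, inner_sum,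
        inner_smul_right]
    rw [e]
    have hex : ∃ j, 0 < M.P i j := by
      by_contra hcon
      push Not at hcon
      have : ∑ j, M.P i j ≤ 0 := Finset.sum_nonpos fun j _ => hcon j
      have h1 := hP.2 i
      linarith
    obtain ⟨j, hj⟩ := hex
    refine Finset.sum_neg' (fun k _ => ?_) ⟨j, Finset.mem_univ j, ?_⟩
    · exact mul_nonpos_of_nonneg_of_nonpos (hP.1 i k) (hM.negDef k v hv).le
    · exact mul_neg_of_pos_of_neg hj (hM.negDef j v hv)
  have hdet : IsUnit (Q + Q.transpose).det := by
    rw [← Matrix.isUnit_iff_isUnit_det, ← Matrix.mulVec_injective_iff_isUnit]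
    intro u v huv
    by_contra hne
    have hne' : WithLp.toLp 2 (u - v) ≠ (0 : Vec n) := by
      intro h0
      apply hne
      have : u - v = 0 := by simpa using congrArg WithLp.ofLp h0
      exact sub_eq_zero.1 this
    have h0 : Matrix.toEuclideanLin (Q + Q.transpose) (WithLp.toLp 2 (u - v)) = 0 := by
      rw [Matrix.toLpLin_apply]
      simp only [Matrix.mulVec_sub]
      rw [huv, sub_self, WithLp.toLp_zero]
    have h1 := hneg _ hne'
    have h2 : ⟪WithLp.toLp 2 (u - v),
        Matrix.toEuclideanLin (Q + Q.transpose) (WithLp.toLp 2 (u - v))⟫ = (0 : ℝ) := by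
      rw [h0, inner_zero_right]
    rw [map_add, LinearMap.add_apply, inner_add_right, inner_transpose, real_inner_comm] at h2
    rw [real_inner_comm] at h1
    linarith
  have hfoc : Matrix.toEuclideanLin (Q + Q.transpose) (M.optimalInput i) = -β := by
    unfold Model.optimalInput
    rw [hH, map_neg, Matrix.toLpLin_apply, Matrix.toLpLin_apply]
    simp [Matrix.mulVec_mulVec, Matrix.mul_nonsing_inv _ hdet, hβ]
  set xs := M.optimalInput i with hxs
  have hd := hneg (x - xs) (sub_ne_zero.2 hx)
  have hf : ⟪x - xs, Matrix.toEuclideanLin (Q + Q.transpose) xs⟫ = -⟪x - xs, β⟫ := by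
    rw [hfoc, inner_neg_right]
  rw [map_add, LinearMap.add_apply, inner_add_right, inner_transpose] at hf
  rw [Model.stageCost_eq hM, Model.stageCost_eq hM, ← hQ, ← hβ]
  simp only [map_sub, inner_sub_left, inner_sub_right] at hd hf
  have c1 := real_inner_comm xs (Matrix.toEuclideanLin Q x)
  have c2 := real_inner_comm xs (Matrix.toEuclideanLin Q xs)
  linarith

end MarkovJump

end

/-
Fix a state `i`. Each completed pair of visits performs a projected stochastic gradient step on the
stage cost of `i`: this cost is quadratic, so the symmetric difference is an exact directional
derivative, and the perturbation `Δ` satisfies `𝔼 (⟨v, Δ⟩ Δ̄) = v`. By strong monotonicity of the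
gradient, a step decreases the mean square distance to `x_i^*` by a multiple of
`a_k ‖x̂_k - x_i^*‖²`, up to an error of order `(a_k / c_k)²`, which is summable. Other states are
visited between the two measurements of a pair, so the Lyapunov function averages over the second
measurement while it is pending, and it carries the tail of the error series. It is then a
nonnegative supermartingale that is constant between the visits to `i`, so it converges and its mean
decreases are summable; since `∑ a_k = ∞`, its limit is `0`. The inputs differ from the estimates by
at most a bounded multiple of `c_k → 0`, and they are uniformly bounded, so dominated convergence
upgrades the almost sure limit to mean square.
-/

namespace MarkovJump

section Projection

variable {n : ℕ} {S : Set (Vec n)}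

theorem proj_mem (hS : IsCompact S) (hne : S.Nonempty) (x : Vec n) : proj S x ∈ S :=
  (proj_spec hS hne x).1

theorem inner_sub_proj_sub_proj_nonpos (hc : Convex ℝ S) (hS : IsCompact S) (x : Vec n)
    {z : Vec n} (hz : z ∈ S) : ⟪x - proj S x, z - proj S x⟫ ≤ 0 := by
  obtain ⟨hmem, hmin⟩ := proj_spec hS ⟨z, hz⟩ x
  have : Nonempty S := ⟨⟨z, hz⟩⟩
  refine (norm_eq_iInf_iff_real_inner_le_zero hc hmem).1 (le_antisymm ?_ ?_) z hz
  · exact le_ciInf fun y => hmin y y.2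
  · exact ciInf_le ⟨0, Set.forall_mem_range.2 fun y => norm_nonneg _⟩ (⟨_, hmem⟩ : S)

theorem lipschitzWith_one_proj (hc : Convex ℝ S) (hS : IsCompact S) (hne : S.Nonempty) :
    LipschitzWith 1 (proj S) := by
  refine LipschitzWith.of_dist_le_mul fun x y => ?_
  rw [NNReal.coe_one, one_mul, dist_eq_norm, dist_eq_norm]
  have hx := inner_sub_proj_sub_proj_nonpos hc hS x (proj_mem hS hne y)
  have hy := inner_sub_proj_sub_proj_nonpos hc hS y (proj_mem hS hne x)
  have hsq : ‖proj S x - proj S y‖ ^ 2 ≤ ⟪x - y, proj S x - proj S y⟫ := by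
    rw [← real_inner_self_eq_norm_sq]
    simp only [inner_sub_left, inner_sub_right] at *
    linarith
  have hCS := real_inner_le_norm (x - y) (proj S x - proj S y)
  rcases (norm_nonneg (proj S x - proj S y)).eq_or_lt with h | h
  · exact h ▸ norm_nonneg _
  · nlinarith

theorem proj_eq_self (hS : IsCompact S) {x : Vec n} (hx : x ∈ S) : proj S x = x := by
  have h := (proj_spec hS ⟨x, hx⟩ x).2 x hx
  rw [sub_self, norm_zero, norm_le_zero_iff, sub_eq_zero] at h
  exact h.symm

theorem norm_proj_sub_le (hc : Convex ℝ S) (hS : IsCompact S) {z : Vec n} (hz : z ∈ S)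
    (x : Vec n) : ‖proj S x - z‖ ≤ ‖x - z‖ := by
  simpa only [proj_eq_self hS hz, NNReal.coe_one, one_mul]
    using (lipschitzWith_one_proj hc hS ⟨z, hz⟩).norm_sub_le x z

end Projection

section Quadratic

variable {E : Type*} [NormedAddCommGroup E] [InnerProductSpace ℝ E]

theorem eq_zero_of_forall_nonneg_mul_add_mul_sq {l q : ℝ} (h : ∀ t : ℝ, 0 ≤ l * t + q * t ^ 2) :
    l = 0 := by
  have hdisc : discrim q l 0 ≤ 0 := discrim_le_zero fun t => by linarith [h t]
  rw [discrim, mul_zero, sub_zero] at hdisc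
  exact pow_eq_zero_iff two_ne_zero |>.1 (hdisc.antisymm (sq_nonneg l))

theorem inner_map_sub_inner_eq_add_of_forall_le (T : E →ₗ[ℝ] E) {β o : E}
    (hmin : ∀ z, ⟪o, T o⟫ - ⟪o, β⟫ ≤ ⟪z, T z⟫ - ⟪z, β⟫) (x : E) :
    ⟪x, T x⟫ - ⟪x, β⟫ = ⟪o, T o⟫ - ⟪o, β⟫ + ⟪x - o, T (x - o)⟫ := by
  set y := x - o
  have hx : x = o + (1 : ℝ) • y := by simp [y]
  have hline : ∀ t : ℝ, ⟪o + t • y, T (o + t • y)⟫ - ⟪o + t • y, β⟫ =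
      ⟪o, T o⟫ - ⟪o, β⟫ + ((⟪y, T o⟫ + ⟪o, T y⟫ - ⟪y, β⟫) * t + ⟪y, T y⟫ * t ^ 2) := fun t => by
    simp only [map_add, map_smul, inner_add_left, inner_add_right, inner_smul_left,
      inner_smul_right, RCLike.conj_to_real]
    ring
  have hderiv : ⟪y, T o⟫ + ⟪o, T y⟫ - ⟪y, β⟫ = 0 :=
    eq_zero_of_forall_nonneg_mul_add_mul_sq (q := ⟪y, T y⟫) fun t => by
      linarith [hmin (o + t • y), hline t]
  rw [hx, hline, hderiv]
  ring

theorem exists_pos_mul_norm_sq_le_inner_map [FiniteDimensional ℝ E] (T : E →ₗ[ℝ] E)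
    (hT : ∀ y, y ≠ 0 → 0 < ⟪y, T y⟫) : ∃ l > 0, ∀ y, l * ‖y‖ ^ 2 ≤ ⟪y, T y⟫ := by
  rcases subsingleton_or_nontrivial E with hE | hE
  · exact ⟨1, one_pos, fun y => by simp [Subsingleton.elim y 0]⟩
  have hcont : Continuous fun y => ⟪y, T y⟫ :=
    continuous_id.inner T.continuous_of_finiteDimensional
  obtain ⟨z, hz, hmin⟩ := (isCompact_sphere (0 : E) 1).exists_isMinOn
    (NormedSpace.sphere_nonempty.2 zero_le_one) hcont.continuousOn
  refine ⟨_, hT z (ne_zero_of_mem_unit_sphere ⟨z, hz⟩), fun y => ?_⟩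
  rcases eq_or_ne y 0 with rfl | hy
  · simp
  have hle : ⟪z, T z⟫ ≤ ‖y‖⁻¹ * (‖y‖⁻¹ * ⟪y, T y⟫) := by
    simpa only [Set.mem_ofPred_eq, map_smul, inner_smul_left, inner_smul_right, RCLike.conj_to_real]
      using hmin (show ‖y‖⁻¹ • y ∈ Metric.sphere (0 : E) 1 by simp [norm_smul, hy])
  calc ⟪z, T z⟫ * ‖y‖ ^ 2 ≤ ‖y‖⁻¹ * (‖y‖⁻¹ * ⟪y, T y⟫) * ‖y‖ ^ 2 := by gcongr
    _ = ⟪y, T y⟫ := by field_simp [norm_ne_zero_iff.2 hy]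

end Quadratic

section Cost

variable {K n : ℕ} {M : Model K n}

/-- The quadratic part of the stage cost after the state `i`, as a linear map that need not be
symmetric. -/
noncomputable def Model.quad (M : Model K n) (i : Fin K) : Vec n →ₗ[ℝ] Vec n :=
  -Matrix.toEuclideanLin (∑ j, M.P i j • M.A j)

theorem Model.stageCost_eq_add_quad (hM : M.IsAdmissible) (i : Fin K) (x : Vec n) :
    M.stageCost i x = M.stageCost i (M.optimalInput i) +
      ⟪x - M.optimalInput i, M.quad i (x - M.optimalInput i)⟫ := by
  have hquad : ∀ z, M.stageCost i z = ⟪z, M.quad i z⟫ - ⟪z, ∑ j, M.P i j • M.b j⟫ := fun z => by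
    rw [Model.stageCost_eq hM, Model.quad, LinearMap.neg_apply, inner_neg_right]
  simp only [hquad]
  refine inner_map_sub_inner_eq_add_of_forall_le _ (fun z => ?_) x
  rw [← hquad, ← hquad]
  rcases eq_or_ne z (M.optimalInput i) with rfl | h
  · exact le_rfl
  · exact (Model.stageCost_optimalInput_lt hM i z h).le

theorem Model.inner_quad_pos (hM : M.IsAdmissible) (i : Fin K) {y : Vec n} (hy : y ≠ 0) :
    0 < ⟪y, M.quad i y⟫ := by
  have hlt := Model.stageCost_optimalInput_lt hM i (M.optimalInput i + y) (by simpa using hy)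
  rw [Model.stageCost_eq_add_quad hM i (M.optimalInput i + y), add_sub_cancel_left] at hlt
  linarith

/-- The gradient of the stage cost after the state `i`, written through the deviation from the
optimal input. -/
noncomputable def Model.costGradient (M : Model K n) (i : Fin K) (x : Vec n) : Vec n :=
  M.quad i (x - M.optimalInput i) + LinearMap.adjoint (M.quad i) (x - M.optimalInput i)

theorem Model.inner_sub_optimalInput_costGradient (M : Model K n) (i : Fin K) (x : Vec n) :
    ⟪x - M.optimalInput i, M.costGradient i x⟫ =
      2 * ⟪x - M.optimalInput i, M.quad i (x - M.optimalInput i)⟫ := by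
  rw [Model.costGradient, inner_add_right, LinearMap.adjoint_inner_right, real_inner_comm, two_mul]

theorem Model.exists_pos_mul_norm_sq_le_inner_costGradient (hM : M.IsAdmissible) (i : Fin K) :
    ∃ l > 0, ∀ x, l * ‖x - M.optimalInput i‖ ^ 2 ≤ ⟪x - M.optimalInput i, M.costGradient i x⟫ := by
  obtain ⟨l, hl, h⟩ :=
    exists_pos_mul_norm_sq_le_inner_map (M.quad i) fun y hy => Model.inner_quad_pos hM i hy
  refine ⟨2 * l, by positivity, fun x => ?_⟩
  rw [M.inner_sub_optimalInput_costGradient]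
  linarith [h (x - M.optimalInput i)]

theorem Model.stageCost_add_sub_stageCost_sub (hM : M.IsAdmissible) (i : Fin K) (x v : Vec n)
    (c : ℝ) :
    M.stageCost i (x + c • v) - M.stageCost i (x - c • v) = 2 * c * ⟪M.costGradient i x, v⟫ := by
  rw [Model.stageCost_eq_add_quad hM i (x + c • v), Model.stageCost_eq_add_quad hM i (x - c • v),
    Model.costGradient, inner_add_left, LinearMap.adjoint_inner_left, add_sub_right_comm,
    sub_right_comm]
  simp only [map_add, map_sub, map_smul, inner_add_left, inner_add_right, inner_sub_left,
    inner_sub_right, inner_smul_left, inner_smul_right, RCLike.conj_to_real]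
  rw [real_inner_comm v, real_inner_comm v]
  ring

/-- The joint law of the next state and the noise of the next stage after the state `i`. -/
noncomputable def Model.nextLaw (M : Model K n) (i : Fin K) : Measure (Fin K × Vec n) :=
  ∑ j, ENNReal.ofReal (M.P i j) • (M.f j).map (Prod.mk j)

theorem Model.nextLaw_singleton_prod (M : Model K n) (i j : Fin K) {B : Set (Vec n)}
    (hB : MeasurableSet B) :
    M.nextLaw i ({j} ×ˢ B) = ENNReal.ofReal (M.P i j) * M.f j B := by
  have hmap : ∀ k, (M.f k).map (Prod.mk k) ({j} ×ˢ B) = if k = j then M.f k B else 0 := fun k => by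
    rw [Measure.map_apply measurable_prodMk_left ((measurableSet_singleton j).prod hB)]
    split_ifs with hkj <;>
      simp [hkj, Set.mk_preimage_prod_right, Set.mk_preimage_prod_right_eq_empty]
  simp [Model.nextLaw, hmap]

theorem Model.isProbabilityMeasure_nextLaw (hM : M.IsAdmissible) (i : Fin K) :
    IsProbabilityMeasure (M.nextLaw i) := by
  have hP := Matrix.mem_rowStochastic_iff_sum.1 hM.stochastic
  have huniv : ∀ j, (M.f j).map (Prod.mk j) Set.univ = 1 := fun j => by
    have := hM.isProb j
    rw [Measure.map_apply measurable_prodMk_left MeasurableSet.univ, Set.preimage_univ,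
      measure_univ]
  constructor
  simp only [Model.nextLaw, Measure.coe_finsetSum, Finset.sum_apply, Measure.smul_apply,
    smul_eq_mul, huniv, mul_one]
  rw [← ENNReal.ofReal_sum_of_nonneg fun j _ => hP.1 i j, hP.2 i, ENNReal.ofReal_one]

theorem Model.integrable_nextLaw (i : Fin K) {g : Fin K × Vec n → ℝ} (hg : Measurable g)
    (h : ∀ j, Integrable (fun w => g (j, w)) (M.f j)) : Integrable g (M.nextLaw i) :=
  integrable_finsetSum_measure.2 fun j _ =>
    ((integrable_map_measure hg.aestronglyMeasurable measurable_prodMk_left.aemeasurable).2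
      (h j)).smul_measure ENNReal.ofReal_ne_top

theorem Model.integral_nextLaw (hM : M.IsAdmissible) (i : Fin K) {g : Fin K × Vec n → ℝ}
    (hg : Measurable g) (h : ∀ j, Integrable (fun w => g (j, w)) (M.f j)) :
    ∫ z, g z ∂M.nextLaw i = ∑ j, M.P i j * ∫ w, g (j, w) ∂M.f j := by
  have hP := Matrix.mem_rowStochastic_iff_sum.1 hM.stochastic
  rw [Model.nextLaw, integral_finsetSum_measure fun j _ =>
    ((integrable_map_measure hg.aestronglyMeasurable measurable_prodMk_left.aemeasurable).2
      (h j)).smul_measure ENNReal.ofReal_ne_top]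
  refine Finset.sum_congr rfl fun j _ => ?_
  rw [integral_smul_measure, integral_map measurable_prodMk_left.aemeasurable
    hg.aestronglyMeasurable, ENNReal.toReal_ofReal (hP.1 i j), smul_eq_mul]

/-- The observed cost of the input `x` when `z` is the pair of the next state and the noise. -/
noncomputable def Model.cost (M : Model K n) (x : Vec n) (z : Fin K × Vec n) : ℝ :=
  -⟪x, M.output z.1 x z.2⟫

theorem Model.measurable_output (M : Model K n) :
    Measurable fun q : Fin K × Vec n × Vec n => M.output q.1 q.2.1 q.2.2 := by
  refine measurable_from_prod_countable_right fun j => ?_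
  have hA := (Matrix.toEuclideanLin (M.A j)).continuous_of_finiteDimensional
  have hout : Continuous fun q : Vec n × Vec n => M.output j q.1 q.2 := by
    unfold Model.output
    fun_prop
  exact hout.measurable

@[fun_prop]
theorem Model.measurable_cost (M : Model K n) :
    Measurable fun q : Vec n × Fin K × Vec n => M.cost q.1 q.2 := by
  have hout := M.measurable_output.comp
    (f := fun q : Vec n × Fin K × Vec n => (q.2.1, q.1, q.2.2)) (by fun_prop)
  exact (measurable_fst.inner hout).neg

theorem Model.measurable_cost_right (M : Model K n) (x : Vec n) : Measurable (M.cost x) :=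
  M.measurable_cost.comp (g := fun q : Vec n × Fin K × Vec n => M.cost q.1 q.2)
    (f := fun z => (x, z)) measurable_prodMk_left

theorem Model.exists_norm_output_le (M : Model K n) :
    ∃ κ, ∀ k x w, ‖M.output k x w‖ ≤ κ * (‖x‖ + 1) + ‖w‖ := by
  let A k := LinearMap.toContinuousLinearMap (Matrix.toEuclideanLin (M.A k))
  obtain ⟨κ, hκ⟩ := (Set.finite_range fun k => ‖A k‖ + ‖M.b k‖).bddAbove
  refine ⟨κ, fun k x w => norm_add₃_le.trans ?_⟩
  have hAx : ‖Matrix.toEuclideanLin (M.A k) x‖ ≤ ‖A k‖ * ‖x‖ := (A k).le_opNorm x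
  have hk : ‖A k‖ + ‖M.b k‖ ≤ κ := hκ ⟨k, rfl⟩
  nlinarith [norm_nonneg (A k), norm_nonneg (M.b k), norm_nonneg x]

theorem Model.exists_sq_cost_le (M : Model K n) (ρ : ℝ) :
    ∃ C, ∀ x : Vec n, ‖x‖ ≤ ρ → ∀ z, M.cost x z ^ 2 ≤ C * (1 + ‖z.2‖ ^ 2) := by
  obtain ⟨κ, hκ⟩ := M.exists_norm_output_le
  refine ⟨2 * ρ ^ 2 * ((|κ| * (ρ + 1)) ^ 2 + 1), fun x hx z => ?_⟩
  have hcost : |M.cost x z| ≤ ρ * (|κ| * (ρ + 1) + ‖z.2‖) := by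
    rw [Model.cost, abs_neg]
    refine (abs_real_inner_le_norm _ _).trans ?_
    have hρ := (norm_nonneg x).trans hx
    gcongr
    refine (hκ z.1 x z.2).trans ?_
    gcongr
    exact le_abs_self κ
  calc M.cost x z ^ 2 ≤ (ρ * (|κ| * (ρ + 1) + ‖z.2‖)) ^ 2 :=
        sq_le_sq.2 (hcost.trans (le_abs_self _))
    _ = ρ ^ 2 * (|κ| * (ρ + 1) + ‖z.2‖) ^ 2 := mul_pow _ _ _
    _ ≤ ρ ^ 2 * (2 * ((|κ| * (ρ + 1)) ^ 2 + ‖z.2‖ ^ 2)) := by gcongr; exact add_sq_le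
    _ ≤ 2 * ρ ^ 2 * ((|κ| * (ρ + 1)) ^ 2 + 1) * (1 + ‖z.2‖ ^ 2) := by
        nlinarith [sq_nonneg ρ, mul_nonneg (sq_nonneg ρ) (sq_nonneg (|κ| * (ρ + 1) * ‖z.2‖))]

theorem Model.integrable_one_add_norm_sq_snd (hM : M.IsAdmissible) (i : Fin K) :
    Integrable (fun z : Fin K × Vec n => 1 + ‖z.2‖ ^ 2) (M.nextLaw i) :=
  Model.integrable_nextLaw i (by fun_prop) fun j =>
    have := hM.isProb j
    (integrable_const 1).add (hM.memLp j).norm.integrable_sq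

theorem Model.memLp_cost (hM : M.IsAdmissible) (i : Fin K) (x : Vec n) :
    MemLp (M.cost x) 2 (M.nextLaw i) := by
  obtain ⟨C, hC⟩ := M.exists_sq_cost_le ‖x‖
  refine (memLp_two_iff_integrable_sq (M.measurable_cost_right x).aestronglyMeasurable).2 <|
    ((M.integrable_one_add_norm_sq_snd hM i).const_mul C).mono'
      ((M.measurable_cost_right x).pow_const 2).aestronglyMeasurable (ae_of_all _ fun z => ?_)
  rw [Real.norm_of_nonneg (sq_nonneg _)]
  exact hC x le_rfl z

theorem Model.integral_cost (hM : M.IsAdmissible) (i : Fin K) (x : Vec n) :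
    ∫ z, M.cost x z ∂M.nextLaw i = M.stageCost i x := by
  refine Model.integral_nextLaw hM i (M.measurable_cost_right x) fun j => ?_
  have := hM.isProb j
  have hw : Integrable (fun w : Vec n => w) (M.f j) := (hM.memLp j).integrable one_le_two
  exact (((integrable_const (Matrix.toEuclideanLin (M.A j) x + M.b j)).add hw).const_inner x).neg

theorem Model.exists_integral_sq_cost_le (hM : M.IsAdmissible) (ρ : ℝ) :
    ∃ C, ∀ i, ∀ x : Vec n, ‖x‖ ≤ ρ → ∫ z, M.cost x z ^ 2 ∂M.nextLaw i ≤ C := by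
  obtain ⟨C, hC⟩ := M.exists_sq_cost_le ρ
  obtain ⟨B, hB⟩ :=
    (Set.finite_range fun i => ∫ z, C * (1 + ‖z.2‖ ^ 2) ∂M.nextLaw i).bddAbove
  exact ⟨B, fun i x hx => (integral_mono (M.memLp_cost hM i x).integrable_sq
    ((M.integrable_one_add_norm_sq_snd hM i).const_mul C) (hC x hx)).trans (hB ⟨i, rfl⟩)⟩

end Cost

section PerturbationLaw

variable {n : ℕ} {ν : Measure ℝ} {ξ₁ ξ₂ : ℝ}

/-- The vector of the reciprocals of the entries (with `1 / 0 = 0`). -/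
noncomputable def recip (v : Vec n) : Vec n := WithLp.toLp 2 fun j => 1 / v j

@[fun_prop]
theorem measurable_recip : Measurable (recip : Vec n → Vec n) :=
  (WithLp.measurable_toLp 2 _).comp <| measurable_pi_lambda _ fun j =>
    measurable_const.div (by fun_prop)

theorem inner_recip_mul_inner (y v d : Vec n) :
    ⟪y, recip d⟫ * ⟪v, d⟫ = ∑ j, ∑ l, y j * v l * (1 / d j * d l) := by
  simp only [PiLp.inner_apply, recip, RCLike.inner_apply, RCLike.conj_to_real]
  rw [Finset.sum_mul_sum]
  exact Finset.sum_congr rfl fun j _ => Finset.sum_congr rfl fun l _ => by ring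

theorem norm_recip_sq (d : Vec n) : ‖recip d‖ ^ 2 = ∑ j, (1 / d j) ^ 2 := by
  simp [EuclideanSpace.norm_sq_eq, recip]

/-- The law of a vector with independent entries of law `ν`. -/
noncomputable def vecLaw (ν : Measure ℝ) (n : ℕ) : Measure (Vec n) :=
  (Measure.pi fun _ : Fin n => ν).map (WithLp.toLp 2)

instance [IsProbabilityMeasure ν] : IsProbabilityMeasure (vecLaw ν n) :=
  Measure.isProbabilityMeasure_map (WithLp.measurable_toLp 2 _).aemeasurable

theorem map_ofLp_vecLaw (ν : Measure ℝ) (n : ℕ) :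
    (vecLaw ν n).map WithLp.ofLp = Measure.pi fun _ => ν := by
  rw [vecLaw, Measure.map_map (by fun_prop) (by fun_prop), Function.comp_def, Measure.map_id']

theorem measurePreserving_apply_vecLaw [IsProbabilityMeasure ν] (j : Fin n) :
    MeasurePreserving (fun d : Vec n => d j) (vecLaw ν n) ν :=
  (measurePreserving_eval (fun _ => ν) j).comp
    ⟨WithLp.measurable_ofLp 2 _, map_ofLp_vecLaw ν n⟩

theorem integral_apply_vecLaw [IsProbabilityMeasure ν] {f : ℝ → ℝ} (hf : AEStronglyMeasurable f ν)
    (j : Fin n) : ∫ d : Vec n, f (d j) ∂vecLaw ν n = ∫ z, f z ∂ν := by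
  have hmp := measurePreserving_apply_vecLaw (ν := ν) j
  have hmap := integral_map hmp.aemeasurable (f := f) (hmp.map_eq.symm ▸ hf)
  rwa [hmp.map_eq, eq_comm] at hmap

theorem iIndepFun_apply_vecLaw [IsProbabilityMeasure ν] :
    iIndepFun (fun (j : Fin n) (d : Vec n) => d j) (vecLaw ν n) := by
  rw [iIndepFun_iff_map_fun_eq_pi_map fun j => by fun_prop]
  simp only [(measurePreserving_apply_vecLaw _).map_eq]
  exact map_ofLp_vecLaw ν n

theorem norm_le_sqrt_of_forall_abs_le {d : Vec n} {r : ℝ} (h : ∀ j, |d j| ≤ r) :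
    ‖d‖ ≤ √(n * r ^ 2) := by
  rw [EuclideanSpace.norm_eq]
  refine Real.sqrt_le_sqrt ?_
  calc ∑ j, ‖d j‖ ^ 2 ≤ ∑ _j : Fin n, r ^ 2 :=
        Finset.sum_le_sum fun j _ => pow_le_pow_left₀ (norm_nonneg _) (h j) 2
    _ = n * r ^ 2 := by simp

namespace IsPerturbationLaw

variable (h : IsPerturbationLaw ν ξ₁ ξ₂)
include h

theorem ae_ne_zero : ∀ᵐ z ∂ν, z ≠ 0 := by
  have hm : Measurable fun z : ℝ => (ENNReal.ofReal (z ^ 2))⁻¹ := by fun_prop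
  filter_upwards [ae_lt_top hm (h.inv_sq.trans_lt ENNReal.ofReal_lt_top).ne] with z hz h0
  simp [h0] at hz

theorem memLp_id : MemLp (fun z : ℝ => z) 2 ν :=
  have := h.isProb
  MemLp.of_bound measurable_id.aestronglyMeasurable ξ₁ h.bounded

theorem integral_id : ∫ z, z ∂ν = 0 := by
  have hneg : ∫ z, z ∂ν = ∫ z, -z ∂ν := by
    conv_lhs => rw [← h.symm]
    exact integral_map measurable_neg.aemeasurable measurable_id.aestronglyMeasurable
  rw [integral_neg] at hneg
  linarith

theorem lintegral_one_div_sq_le : ∫⁻ z, ENNReal.ofReal ((1 / z) ^ 2) ∂ν ≤ ENNReal.ofReal ξ₂ := by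
  refine le_trans (lintegral_mono_ae ?_) h.inv_sq
  filter_upwards [h.ae_ne_zero] with z hz
  rw [one_div, inv_pow, ENNReal.ofReal_inv_of_pos (by positivity)]

theorem integrable_one_div_sq : Integrable (fun z : ℝ => (1 / z) ^ 2) ν := by
  refine ⟨((measurable_const.div measurable_id).pow_const 2).aestronglyMeasurable, ?_⟩
  rw [hasFiniteIntegral_iff_ofReal (ae_of_all _ fun z => sq_nonneg _)]
  exact h.lintegral_one_div_sq_le.trans_lt ENNReal.ofReal_lt_top

theorem integral_one_div_sq_le : ∫ z, (1 / z) ^ 2 ∂ν ≤ max ξ₂ 0 := by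
  rw [integral_eq_lintegral_of_nonneg_ae (ae_of_all _ fun z => sq_nonneg _)
    h.integrable_one_div_sq.aestronglyMeasurable]
  exact ENNReal.toReal_le_of_le_ofReal (le_max_right _ _)
    (h.lintegral_one_div_sq_le.trans (ENNReal.ofReal_le_ofReal (le_max_left _ _)))

theorem memLp_one_div : MemLp (fun z : ℝ => 1 / z) 2 ν :=
  (memLp_two_iff_integrable_sq (measurable_const.div measurable_id).aestronglyMeasurable).2
    h.integrable_one_div_sq

theorem integrable_one_div_apply_mul_apply (j l : Fin n) :
    Integrable (fun d : Vec n => 1 / d j * d l) (vecLaw ν n) :=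
  have := h.isProb
  (h.memLp_one_div.comp_measurePreserving (measurePreserving_apply_vecLaw j)).integrable_mul
    (h.memLp_id.comp_measurePreserving (measurePreserving_apply_vecLaw l))

theorem integral_one_div_apply_mul_apply (j l : Fin n) :
    ∫ d : Vec n, 1 / d j * d l ∂vecLaw ν n = if j = l then 1 else 0 := by
  have := h.isProb
  have hmp := measurePreserving_apply_vecLaw (ν := ν) (n := n)
  split_ifs with hjl
  · have hone : ∀ᵐ d : Vec n ∂vecLaw ν n, 1 / d j * d l = 1 := by
      filter_upwards [(hmp l).quasiMeasurePreserving.ae h.ae_ne_zero] with d hd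
      rw [hjl, one_div_mul_cancel hd]
    rw [integral_congr_ae hone, integral_const, probReal_univ, one_smul]
  · have hind : IndepFun (fun d : Vec n => 1 / d j) (fun d => d l) (vecLaw ν n) :=
      (iIndepFun_apply_vecLaw.indepFun hjl).comp (φ := fun z => 1 / z) (ψ := id)
        (measurable_const.div measurable_id) measurable_id
    have hmean : ∫ d : Vec n, d l ∂vecLaw ν n = 0 :=
      (integral_apply_vecLaw h.memLp_id.1 l).trans h.integral_id
    rw [hind.integral_fun_mul_eq_mul_integral
      (h.memLp_one_div.comp_measurePreserving (hmp j)).aestronglyMeasurable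
      (h.memLp_id.comp_measurePreserving (hmp l)).aestronglyMeasurable, hmean, mul_zero]

theorem integrable_inner_recip_mul_inner (y v : Vec n) :
    Integrable (fun d => ⟪y, recip d⟫ * ⟪v, d⟫) (vecLaw ν n) := by
  simp only [inner_recip_mul_inner]
  exact integrable_finsetSum _ fun j _ => integrable_finsetSum _ fun l _ =>
    (h.integrable_one_div_apply_mul_apply j l).const_mul _

theorem integral_inner_recip_mul_inner (y v : Vec n) :
    ∫ d, ⟪y, recip d⟫ * ⟪v, d⟫ ∂vecLaw ν n = ⟪y, v⟫ := by
  have hint := fun j l : Fin n =>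
    (h.integrable_one_div_apply_mul_apply j l).const_mul (y j * v l)
  simp only [inner_recip_mul_inner]
  rw [integral_finsetSum _ fun j _ => integrable_finsetSum _ fun l _ => hint j l]
  simp only [integral_finsetSum _ fun l _ => hint _ l, integral_const_mul,
    h.integral_one_div_apply_mul_apply, PiLp.inner_apply, RCLike.inner_apply, RCLike.conj_to_real]
  simp [mul_comm]

theorem integrable_norm_recip_sq : Integrable (fun d => ‖recip d‖ ^ 2) (vecLaw ν n) := by
  have := h.isProb
  simp only [norm_recip_sq]
  exact integrable_finsetSum _ fun j _ =>
    (measurePreserving_apply_vecLaw j).integrable_comp_of_integrable h.integrable_one_div_sq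

theorem integral_norm_recip_sq_le : ∫ d, ‖recip d‖ ^ 2 ∂vecLaw ν n ≤ n * max ξ₂ 0 := by
  have := h.isProb
  have hint : ∀ j, Integrable (fun d : Vec n => (1 / d j) ^ 2) (vecLaw ν n) := fun j =>
    (measurePreserving_apply_vecLaw j).integrable_comp_of_integrable h.integrable_one_div_sq
  simp only [norm_recip_sq]
  rw [integral_finsetSum _ fun j _ => hint j]
  calc ∑ j, ∫ d : Vec n, (1 / d j) ^ 2 ∂vecLaw ν n ≤ ∑ _j : Fin n, max ξ₂ 0 :=
        Finset.sum_le_sum fun j _ =>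
          (integral_apply_vecLaw h.integrable_one_div_sq.1 j).trans_le h.integral_one_div_sq_le
    _ = n * max ξ₂ 0 := by simp

theorem ae_norm_le : ∀ᵐ d ∂vecLaw ν n, ‖d‖ ≤ √(n * ξ₁ ^ 2) := by
  have := h.isProb
  filter_upwards [ae_all_iff.2 fun j =>
    (measurePreserving_apply_vecLaw j).quasiMeasurePreserving.ae h.bounded] with d hd
  exact norm_le_sqrt_of_forall_abs_le hd

end IsPerturbationLaw

end PerturbationLaw

section Step

variable {α : Type*} [MeasurableSpace α] {q : Measure α} [IsProbabilityMeasure q]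

theorem integral_const_add_mul_add_mul {f g : α → ℝ} (hf : Integrable f q) (hg : Integrable g q)
    (A B κ : ℝ) :
    ∫ z, A + B * f z + κ * g z ∂q = A + B * ∫ z, f z ∂q + κ * ∫ z, g z ∂q := by
  have hfB : Integrable (fun z => A + B * f z) q := (integrable_const A).add (hf.const_mul B)
  rw [integral_add hfB (hg.const_mul κ), integral_add (integrable_const A) (hf.const_mul B),
    integral_const_mul, integral_const_mul, integral_const, probReal_univ, one_smul]

theorem memLp_fst_sub_snd {u v : α → ℝ} (hu : MemLp u 2 q) (hv : MemLp v 2 q) :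
    MemLp (fun z : α × α => u z.1 - v z.2) 2 (q.prod q) :=
  (hu.comp_fst q).sub (hv.comp_snd q)

theorem integral_fst_sub_snd {u v : α → ℝ} (hu : Integrable u q) (hv : Integrable v q) :
    ∫ z : α × α, u z.1 - v z.2 ∂q.prod q = ∫ z, u z ∂q - ∫ z, v z ∂q := by
  rw [integral_sub (hu.comp_fst q) (hv.comp_snd q), integral_fun_fst u, integral_fun_snd v]
  simp only [probReal_univ, one_smul]

theorem integral_fst_sub_snd_sq_le {u v : α → ℝ} (hu : MemLp u 2 q) (hv : MemLp v 2 q) :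
    ∫ z : α × α, (u z.1 - v z.2) ^ 2 ∂q.prod q ≤ 2 * (∫ z, u z ^ 2 ∂q + ∫ z, v z ^ 2 ∂q) := by
  have hu2 : Integrable (fun z : α × α => u z.1 ^ 2) (q.prod q) := (hu.comp_fst q).integrable_sq
  have hv2 : Integrable (fun z : α × α => v z.2 ^ 2) (q.prod q) := (hv.comp_snd q).integrable_sq
  calc ∫ z : α × α, (u z.1 - v z.2) ^ 2 ∂q.prod q
      ≤ ∫ z : α × α, 2 * (u z.1 ^ 2 + v z.2 ^ 2) ∂q.prod q :=
        integral_mono (memLp_fst_sub_snd hu hv).integrable_sq ((hu2.add hv2).const_mul 2)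
          fun z => by
            change (u z.1 - v z.2) ^ 2 ≤ 2 * (u z.1 ^ 2 + v z.2 ^ 2)
            nlinarith [sq_nonneg (u z.1 + v z.2)]
    _ = 2 * (∫ z, u z ^ 2 ∂q + ∫ z, v z ^ 2 ∂q) := by
        rw [integral_const_mul, integral_add hu2 hv2, integral_fun_fst (fun z => u z ^ 2),
          integral_fun_snd (fun z => v z ^ 2)]
        simp only [probReal_univ, one_smul]

theorem nonneg_and_lintegral_lintegral_le_of_le_quadratic {u v : α → ℝ} (hu : MemLp u 2 q)
    (hv : MemLp v 2 q) {C : ℝ} (huC : ∫ z, u z ^ 2 ∂q ≤ C) (hvC : ∫ z, v z ^ 2 ∂q ≤ C)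
    {A B κ : ℝ} (hκ : 0 ≤ κ) {F : α → α → ℝ} (hF : ∀ z z', 0 ≤ F z z')
    (hle : ∀ z z', F z z' ≤ A + B * (u z - v z') + κ * (u z - v z') ^ 2) :
    0 ≤ A + B * (∫ z, u z ∂q - ∫ z, v z ∂q) + κ * (4 * C) ∧
      ∫⁻ z, ∫⁻ z', ENNReal.ofReal (F z z') ∂q ∂q ≤
        ENNReal.ofReal (A + B * (∫ z, u z ∂q - ∫ z, v z ∂q) + κ * (4 * C)) := by
  set Q : α × α → ℝ := fun z => A + B * (u z.1 - v z.2) + κ * (u z.1 - v z.2) ^ 2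
  have hdiff := memLp_fst_sub_snd hu hv
  have hdiff1 : Integrable (fun z : α × α => u z.1 - v z.2) (q.prod q) :=
    hdiff.integrable one_le_two
  have hQ : Integrable Q (q.prod q) :=
    ((integrable_const A).add (hdiff1.const_mul B)).add (hdiff.integrable_sq.const_mul κ)
  have hQ0 : ∀ z, 0 ≤ Q z := fun z => (hF z.1 z.2).trans (hle z.1 z.2)
  have hQint : ∫ z, Q z ∂q.prod q ≤ A + B * (∫ z, u z ∂q - ∫ z, v z ∂q) + κ * (4 * C) := by
    rw [integral_const_add_mul_add_mul hdiff1 hdiff.integrable_sq,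
      integral_fst_sub_snd (hu.integrable one_le_two) (hv.integrable one_le_two)]
    gcongr
    linarith [integral_fst_sub_snd_sq_le hu hv]
  refine ⟨(integral_nonneg hQ0).trans hQint, ?_⟩
  calc ∫⁻ z, ∫⁻ z', ENNReal.ofReal (F z z') ∂q ∂q
      ≤ ∫⁻ z, ∫⁻ z', ENNReal.ofReal (Q (z, z')) ∂q ∂q :=
        lintegral_mono fun z => lintegral_mono fun z' => ENNReal.ofReal_le_ofReal (hle z z')
    _ = ENNReal.ofReal (∫ z, Q z ∂q.prod q) := by
        rw [ofReal_integral_eq_lintegral_ofReal hQ (ae_of_all _ hQ0),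
          lintegral_prod _ hQ.aestronglyMeasurable.aemeasurable.ennreal_ofReal]
    _ ≤ _ := ENNReal.ofReal_le_ofReal hQint

variable {n : ℕ} {S : Set (Vec n)}

/-- The projected update of simultaneous perturbation stochastic approximation: `x` is the current
estimate, `d` the perturbation, `a` the step size, `c` the perturbation gain, and `δ` the difference
of the costs observed at `x + c • d` and at `x - c • d`. -/
noncomputable def spsaStep (S : Set (Vec n)) (a c : ℝ) (x d : Vec n) (δ : ℝ) : Vec n :=
  proj S (x - (a * (δ / c)) • recip d)

theorem norm_sub_smul_sub_sq {E : Type*} [NormedAddCommGroup E] [InnerProductSpace ℝ E]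
    (x o v : E) (r : ℝ) :
    ‖x - r • v - o‖ ^ 2 = ‖x - o‖ ^ 2 + -2 * r * ⟪x - o, v⟫ + r ^ 2 * ‖v‖ ^ 2 := by
  rw [sub_right_comm, norm_sub_sq_real, inner_smul_right, norm_smul, mul_pow, Real.norm_eq_abs,
    sq_abs]
  ring

theorem norm_spsaStep_sub_sq_le (hc : Convex ℝ S) (hS : IsCompact S) {o : Vec n} (ho : o ∈ S)
    (a c : ℝ) (x d : Vec n) (δ : ℝ) :
    ‖spsaStep S a c x d δ - o‖ ^ 2 ≤
      ‖x - o‖ ^ 2 + -2 * (a / c) * ⟪x - o, recip d⟫ * δ + (a / c) ^ 2 * ‖recip d‖ ^ 2 * δ ^ 2 :=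
  calc ‖spsaStep S a c x d δ - o‖ ^ 2 ≤ ‖x - (a * (δ / c)) • recip d - o‖ ^ 2 :=
        pow_le_pow_left₀ (norm_nonneg _) (norm_proj_sub_le hc hS ho _) 2
    _ = _ := by rw [norm_sub_smul_sub_sq]; ring

theorem nonneg_and_lintegral_lintegral_norm_spsaStep_sub_sq_le (hc : Convex ℝ S) (hS : IsCompact S)
    {o : Vec n} (ho : o ∈ S) {u v : α → ℝ} (hu : MemLp u 2 q) (hv : MemLp v 2 q) {C : ℝ}
    (huC : ∫ z, u z ^ 2 ∂q ≤ C) (hvC : ∫ z, v z ^ 2 ∂q ≤ C) {x d G : Vec n} {a c : ℝ} (hc0 : c ≠ 0)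
    (hgrad : ∫ z, u z ∂q - ∫ z, v z ∂q = 2 * c * ⟪G, d⟫) :
    0 ≤ ‖x - o‖ ^ 2 + -4 * a * (⟪x - o, recip d⟫ * ⟪G, d⟫)
        + 4 * C * (a / c) ^ 2 * ‖recip d‖ ^ 2 ∧
      ∫⁻ z, ∫⁻ z', ENNReal.ofReal (‖spsaStep S a c x d (u z - v z') - o‖ ^ 2) ∂q ∂q ≤
        ENNReal.ofReal (‖x - o‖ ^ 2 + -4 * a * (⟪x - o, recip d⟫ * ⟪G, d⟫)
          + 4 * C * (a / c) ^ 2 * ‖recip d‖ ^ 2) := by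
  have hexp : ‖x - o‖ ^ 2 + -4 * a * (⟪x - o, recip d⟫ * ⟪G, d⟫)
      + 4 * C * (a / c) ^ 2 * ‖recip d‖ ^ 2 =
      ‖x - o‖ ^ 2 + -2 * (a / c) * ⟪x - o, recip d⟫ * (2 * c * ⟪G, d⟫)
        + (a / c) ^ 2 * ‖recip d‖ ^ 2 * (4 * C) := by
    field_simp
    ring
  rw [hexp, ← hgrad]
  exact nonneg_and_lintegral_lintegral_le_of_le_quadratic hu hv huC hvC (by positivity)
    (fun _ _ => sq_nonneg _) fun _ _ => norm_spsaStep_sub_sq_le hc hS ho ..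

theorem lintegral_norm_spsaStep_sub_sq_add_le {ν : Measure ℝ} {ξ₁ ξ₂ : ℝ}
    (hν : IsPerturbationLaw ν ξ₁ ξ₂) (hc : Convex ℝ S) (hS : IsCompact S) {o : Vec n} (ho : o ∈ S)
    {u : Vec n → α → ℝ} (hu : ∀ x, MemLp (u x) 2 q) {x G : Vec n} {a c C : ℝ} (ha : 0 ≤ a)
    (hc0 : 0 < c) (hC : ∀ y, ‖y - x‖ ≤ c * √(n * ξ₁ ^ 2) → ∫ z, u y z ^ 2 ∂q ≤ C)
    (hgrad : ∀ d, ∫ z, u (x + c • d) z ∂q - ∫ z, u (x - c • d) z ∂q = 2 * c * ⟪G, d⟫)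
    (hG : 0 ≤ ⟪x - o, G⟫) :
    ∫⁻ d, ∫⁻ z, ∫⁻ z', ENNReal.ofReal (‖spsaStep S a c x d
        (u (x + c • d) z - u (x - c • d) z') - o‖ ^ 2) ∂q ∂q ∂vecLaw ν n
        + ENNReal.ofReal (4 * a * ⟪x - o, G⟫) ≤
      ENNReal.ofReal (‖x - o‖ ^ 2) + ENNReal.ofReal (4 * C * (n * max ξ₂ 0) * (a / c) ^ 2) := by
  have := hν.isProb
  have hC0 : 0 ≤ C := (integral_nonneg fun z => sq_nonneg _).trans
    (hC x (by rw [sub_self, norm_zero]; positivity))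
  set g : Vec n → ℝ := fun d => ‖x - o‖ ^ 2 + -4 * a * (⟪x - o, recip d⟫ * ⟪G, d⟫)
    + 4 * C * (a / c) ^ 2 * ‖recip d‖ ^ 2 with hg
  have hcond : ∀ᵐ d ∂vecLaw ν n, 0 ≤ g d ∧
      ∫⁻ z, ∫⁻ z', ENNReal.ofReal (‖spsaStep S a c x d
        (u (x + c • d) z - u (x - c • d) z') - o‖ ^ 2) ∂q ∂q ≤ ENNReal.ofReal (g d) := by
    filter_upwards [hν.ae_norm_le] with d hd
    have hcd : ‖c • d‖ ≤ c * √(n * ξ₁ ^ 2) := by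
      rw [norm_smul, Real.norm_of_nonneg hc0.le]
      gcongr
    exact nonneg_and_lintegral_lintegral_norm_spsaStep_sub_sq_le hc hS ho (hu _) (hu _)
      (hC _ (by rwa [add_sub_cancel_left])) (hC _ (by rwa [sub_sub_cancel_left, norm_neg]))
      hc0.ne' (hgrad d)
  have hinner := hν.integrable_inner_recip_mul_inner (x - o) G
  have hnorm := hν.integrable_norm_recip_sq (n := n)
  have hgint : Integrable g (vecLaw ν n) :=
    ((integrable_const _).add (hinner.const_mul _)).add (hnorm.const_mul _)
  have hg0 : 0 ≤ᵐ[vecLaw ν n] g := hcond.mono fun d h => h.1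
  refine (add_le_add_left (lintegral_mono_ae (hcond.mono fun d h => h.2)) _).trans ?_
  rw [← ofReal_integral_eq_lintegral_ofReal hgint hg0,
    ← ENNReal.ofReal_add (integral_nonneg_of_ae hg0) (by positivity),
    ← ENNReal.ofReal_add (by positivity) (by positivity)]
  refine ENNReal.ofReal_le_ofReal ?_
  rw [hg, integral_const_add_mul_add_mul hinner hnorm, hν.integral_inner_recip_mul_inner]
  have hvar := mul_le_mul_of_nonneg_left (hν.integral_norm_recip_sq_le (n := n))
    (show 0 ≤ 4 * C * (a / c) ^ 2 by positivity)
  linarith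

end Step

section Freshness

theorem ext_of_prod_singleton_prod {α β γ : Type*} [MeasurableSpace α] [MeasurableSpace β]
    [MeasurableSpace γ] [Finite β] [MeasurableSingletonClass β] {ρ₁ ρ₂ : Measure (α × β × γ)}
    [IsFiniteMeasure ρ₁] (h : ∀ (A : Set α) (b : β) (C : Set γ), MeasurableSet A →
      MeasurableSet C → ρ₁ (A ×ˢ {b} ×ˢ C) = ρ₂ (A ×ˢ {b} ×ˢ C)) : ρ₁ = ρ₂ := by
  refine Measure.ext_prod₃ fun {A B C} hA _ hC => ?_
  have hsum (ρ : Measure (α × β × γ)) :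
      ρ (A ×ˢ B ×ˢ C) = ∑ b ∈ B.toFinite.toFinset, ρ (A ×ˢ {b} ×ˢ C) := by
    rw [← measure_biUnion_finset]
    · congr 1
      ext ⟨a, b, c⟩
      simp
    · exact fun b _ b' _ hb => Set.disjoint_left.2 fun x hx hx' =>
        hb (hx.2.1.symm.trans hx'.2.1)
    · exact fun b _ => hA.prod ((measurableSet_singleton b).prod hC)
  simp only [hsum, h A _ C hA hC]

variable {K n : ℕ} {Ω : Type*} {s : ℕ → Ω → Fin K} {w D : ℕ → Ω → Vec n}

/-- The perturbation, the next state and the noise of stage `t + 1`. -/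
def fresh (s : ℕ → Ω → Fin K) (w D : ℕ → Ω → Vec n) (t : ℕ) (ω : Ω) : Vec n × Fin K × Vec n :=
  (D t ω, s (t + 1) ω, w t ω)

/-- The event that the states follow the path `σ` up to time `t`, and that the perturbations and
the noise of the first `t` stages lie in the sets `E r` and `B r`. -/
def cylinder (s : ℕ → Ω → Fin K) (w D : ℕ → Ω → Vec n) (t : ℕ) (σ : ℕ → Fin K)
    (E B : ℕ → Set (Vec n)) : Set Ω :=
  {ω | ∀ r < t, D r ω ∈ E r} ∩ {ω | (∀ r ≤ t, s r ω = σ r) ∧ ∀ r < t, w r ω ∈ B r}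

theorem cylinder_inter_preimage_fresh (t : ℕ) (σ : ℕ → Fin K) (E B : ℕ → Set (Vec n)) (j : Fin K)
    (E' B' : Set (Vec n)) :
    cylinder s w D t σ E B ∩ fresh s w D t ⁻¹' (E' ×ˢ {j} ×ˢ B') =
      cylinder s w D (t + 1) (Function.update σ (t + 1) j) (Function.update E t E')
        (Function.update B t B') := by
  ext ω
  have hs (r : ℕ) (hr : r ≤ t) : Function.update σ (t + 1) j r = σ r :=
    Function.update_of_ne (by omega) _ _
  have hE (r : ℕ) (hr : r < t) : Function.update E t E' r = E r :=
    Function.update_of_ne (by omega) _ _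
  have hB (r : ℕ) (hr : r < t) : Function.update B t B' r = B r :=
    Function.update_of_ne (by omega) _ _
  simp +contextual only [cylinder, fresh, Set.mem_inter_iff, Set.mem_ofPred_eq, Set.mem_preimage,
    Set.mem_prod, Set.mem_singleton_iff, Nat.le_succ_iff, Nat.lt_succ_iff_lt_or_eq, or_imp,
    forall_and, forall_eq, Function.update_self, hs, hE, hB]
  tauto

/-- The cylinders up to time `t` with measurable sets of perturbations and noise, which generate
the history up to the observation of `s t`. -/
def cylinders (s : ℕ → Ω → Fin K) (w D : ℕ → Ω → Vec n) (t : ℕ) : Set (Set Ω) :=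
  {A | ∃ σ E B, (∀ r, MeasurableSet (E r)) ∧ (∀ r, MeasurableSet (B r)) ∧
    A = cylinder s w D t σ E B}

theorem isPiSystem_cylinders (s : ℕ → Ω → Fin K) (w D : ℕ → Ω → Vec n) (t : ℕ) :
    IsPiSystem (cylinders s w D t) := by
  rintro _ ⟨σ, E, B, hE, hB, rfl⟩ _ ⟨σ', E', B', hE', hB', rfl⟩ ⟨ω, hω, hω'⟩
  refine ⟨σ, fun r => E r ∩ E' r, fun r => B r ∩ B' r, fun r => (hE r).inter (hE' r),
    fun r => (hB r).inter (hB' r), ?_⟩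
  have hσ (r : ℕ) (hr : r ≤ t) : σ' r = σ r := (hω'.2.1 r hr).symm.trans (hω.2.1 r hr)
  ext ω
  simp +contextual only [cylinder, Set.mem_inter_iff, Set.mem_ofPred_eq, hσ, forall_and]
  tauto

/-- The path that follows `σ` up to time `t` and stays at its last state. -/
def extendPath {t : ℕ} (σ : Fin (t + 1) → Fin K) (r : ℕ) : Fin K := σ (Fin.ofNat (t + 1) r)

theorem mem_cylinder_extendPath (t : ℕ) (ω : Ω) :
    ω ∈ cylinder s w D t (extendPath fun r : Fin (t + 1) => s r ω) (fun _ => Set.univ)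
      fun _ => Set.univ := by
  refine ⟨fun _ _ => trivial, fun r hr => ?_, fun _ _ => trivial⟩
  simp [extendPath, Nat.mod_eq_of_lt (Nat.lt_succ_of_le hr)]

theorem measurableSet_of_forall_inter_cylinder {m : MeasurableSpace Ω} (s : ℕ → Ω → Fin K)
    (w D : ℕ → Ω → Vec n) (t : ℕ) {A : Set Ω} (hA : ∀ σ : ℕ → Fin K, MeasurableSet[m]
      (A ∩ cylinder s w D t σ (fun _ => Set.univ) fun _ => Set.univ)) : MeasurableSet[m] A := by
  have hcover : A = ⋃ σ : Fin (t + 1) → Fin K,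
      A ∩ cylinder s w D t (extendPath σ) (fun _ => Set.univ) fun _ => Set.univ := by
    rw [← Set.inter_iUnion, eq_comm, Set.inter_eq_left]
    exact fun ω _ => Set.mem_iUnion.2 ⟨_, mem_cylinder_extendPath t ω⟩
  rw [hcover]
  exact MeasurableSet.iUnion fun σ => hA _

variable {M : Model K n} [mΩ : MeasurableSpace Ω] {μ : Measure Ω} {ν : Measure ℝ}

/-- The law of `fresh` after the state `i`. -/
noncomputable def Model.freshLaw (M : Model K n) (ν : Measure ℝ) (i : Fin K) :
    Measure (Vec n × Fin K × Vec n) :=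
  (vecLaw ν n).prod (M.nextLaw i)

theorem Model.isProbabilityMeasure_freshLaw [IsProbabilityMeasure ν] (hM : M.IsAdmissible)
    (i : Fin K) : IsProbabilityMeasure (M.freshLaw ν i) := by
  have := M.isProbabilityMeasure_nextLaw hM i
  unfold Model.freshLaw
  infer_instance

theorem measurable_fresh (h : M.IsRealizedBy μ s w) (hD : IsPerturbation μ ν s w D) (t : ℕ) :
    Measurable (fresh s w D t) :=
  (hD.measurable t).prodMk ((h.measurable_state _).prodMk (h.measurable_noise t))

/-- The σ-algebras of the initial state and of the fresh variables of the first `t` stages, that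
is, of all that has happened when the state `s t` has been observed. -/
def historyFiltration (h : M.IsRealizedBy μ s w) (hD : IsPerturbation μ ν s w D) :
    Filtration ℕ mΩ where
  seq t := MeasurableSpace.comap (s 0) ⊤ ⊔
    ⨆ r < t, MeasurableSpace.comap (fresh s w D r) inferInstance
  mono' _ _ htu := sup_le_sup_left (biSup_mono fun _ hr => hr.trans_le htu) _
  le' _ := sup_le (h.measurable_state 0).comap_le <|
    iSup₂_le fun r _ => (measurable_fresh h hD r).comap_le

theorem measurable_fresh_historyFiltration (h : M.IsRealizedBy μ s w)
    (hD : IsPerturbation μ ν s w D) (t : ℕ) :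
    Measurable[historyFiltration h hD (t + 1)] (fresh s w D t) :=
  Measurable.of_comap_le <| le_sup_of_le_right <|
    le_iSup₂_of_le (f := fun r (_ : r < t + 1) => MeasurableSpace.comap (fresh s w D r) _)
      t t.lt_succ_self le_rfl

theorem measurable_state_historyFiltration (h : M.IsRealizedBy μ s w)
    (hD : IsPerturbation μ ν s w D) : ∀ t, Measurable[historyFiltration h hD t] (s t)
  | 0 => Measurable.of_comap_le le_sup_left
  | t + 1 => measurable_fst.comp <| measurable_snd.comp <|
      measurable_fresh_historyFiltration h hD t

theorem IsPerturbation.measurable_apply (hD : IsPerturbation μ ν s w D) (q : ℕ × Fin n) :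
    Measurable fun ω => D q.1 ω q.2 := by
  have := hD.measurable q.1
  fun_prop

theorem IsPerturbation.map_eq [IsProbabilityMeasure μ] (hD : IsPerturbation μ ν s w D) (t : ℕ) :
    μ.map (D t) = vecLaw ν n := by
  have hind : iIndepFun (fun (j : Fin n) ω => D t ω j) μ :=
    hD.indep_entries.precomp (g := fun j : Fin n => (t, j)) fun a b hab => by simpa using hab
  have hpi := (iIndepFun_iff_map_fun_eq_pi_map fun j => (hD.measurable_apply (t, j)).aemeasurable).1
    hind
  simp only [hD.law] at hpi
  rw [vecLaw, ← hpi, Measure.map_map (WithLp.measurable_toLp 2 _)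
    (measurable_pi_lambda _ fun j => hD.measurable_apply (t, j))]
  rfl

theorem IsPerturbation.measure_forall_lt_mem [IsProbabilityMeasure μ]
    (hD : IsPerturbation μ ν s w D) {E : ℕ → Set (Vec n)} (hE : ∀ r, MeasurableSet (E r)) (t : ℕ) :
    μ {ω | ∀ r < t, D r ω ∈ E r} = ∏ r ∈ Finset.range t, vecLaw ν n (E r) := by
  induction t with
  | zero => simp
  | succ t ih =>
    have hdisj : Disjoint (Finset.range t ×ˢ (Finset.univ : Finset (Fin n)))
        ({t} ×ˢ (Finset.univ : Finset (Fin n))) :=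
      Finset.disjoint_product.2 (.inl (by simp))
    have hind : IndepFun (fun ω (r : Fin t) => D r ω) (D t) μ :=
      (hD.indep_entries.indepFun_finset _ _ hdisj hD.measurable_apply).comp
        (φ := fun x (r : Fin t) => WithLp.toLp 2 fun j => x ⟨(r, j), by simp [r.2]⟩)
        (ψ := fun x => WithLp.toLp 2 fun j => x ⟨(t, j), by simp⟩)
        (measurable_pi_lambda _ fun r => (WithLp.measurable_toLp 2 _).comp <|
          measurable_pi_lambda _ fun j => measurable_pi_apply _)
        ((WithLp.measurable_toLp 2 _).comp <|
          measurable_pi_lambda _ fun j => measurable_pi_apply _)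
    have hsplit : {ω | ∀ r < t + 1, D r ω ∈ E r} = {ω | ∀ r < t, D r ω ∈ E r} ∩ D t ⁻¹' E t := by
      ext ω
      simp only [Nat.lt_succ_iff_lt_or_eq, or_imp, forall_and, forall_eq]
      rfl
    have hpast : {ω | ∀ r < t, D r ω ∈ E r} =
        (fun ω (r : Fin t) => D r ω) ⁻¹' Set.univ.pi fun r => E r := by
      ext ω
      simp [Fin.forall_iff]
    rw [Finset.prod_range_succ, ← ih, hsplit, hpast, hind.measure_inter_preimage_eq_mul _ _
      (MeasurableSet.univ_pi fun r => hE r) (hE t), ← Measure.map_apply (hD.measurable t) (hE t),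
      hD.map_eq t]

theorem measure_cylinder [IsProbabilityMeasure μ] [IsProbabilityMeasure ν] (hM : M.IsAdmissible)
    (h : M.IsRealizedBy μ s w) (hD : IsPerturbation μ ν s w D) (t : ℕ) (σ : ℕ → Fin K)
    {E B : ℕ → Set (Vec n)} (hE : ∀ r, MeasurableSet (E r)) (hB : ∀ r, MeasurableSet (B r)) :
    μ (cylinder s w D t σ E B) = μ {ω | s 0 ω = σ 0} *
      ∏ r ∈ Finset.range t, M.freshLaw ν (σ r) (E r ×ˢ {σ (r + 1)} ×ˢ B r) := by
  have hEs : MeasurableSet {d : ℕ → Vec n | ∀ r < t, d r ∈ E r} := by measurability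
  have hBs : MeasurableSet {q : (ℕ → Fin K) × (ℕ → Vec n) |
      (∀ r ≤ t, q.1 r = σ r) ∧ ∀ r < t, q.2 r ∈ B r} := by
    measurability
  have hfresh (r : ℕ) : M.freshLaw ν (σ r) (E r ×ˢ {σ (r + 1)} ×ˢ B r) = vecLaw ν n (E r) *
      (ENNReal.ofReal (M.P (σ r) (σ (r + 1))) * M.f (σ (r + 1)) (B r)) := by
    have := M.isProbabilityMeasure_nextLaw hM (σ r)
    rw [Model.freshLaw, Measure.prod_prod, M.nextLaw_singleton_prod _ _ (hB r)]
  have hind := hD.indep_model.measure_inter_preimage_eq_mul _ _ hEs hBs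
  simp only [Set.preimage_ofPred_eq] at hind
  rw [cylinder, hind, hD.measure_forall_lt_mem hE, h.law t σ B hB]
  simp only [hfresh, Finset.prod_mul_distrib]
  ring

theorem measure_cylinder_inter_preimage_fresh [IsProbabilityMeasure μ] [IsProbabilityMeasure ν]
    (hM : M.IsAdmissible) (h : M.IsRealizedBy μ s w) (hD : IsPerturbation μ ν s w D) (t : ℕ)
    (σ : ℕ → Fin K) {E B : ℕ → Set (Vec n)} (hE : ∀ r, MeasurableSet (E r))
    (hB : ∀ r, MeasurableSet (B r)) {E' B' : Set (Vec n)} (hE' : MeasurableSet E')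
    (hB' : MeasurableSet B') (j : Fin K) :
    μ (cylinder s w D t σ E B ∩ fresh s w D t ⁻¹' (E' ×ˢ {j} ×ˢ B')) =
      μ (cylinder s w D t σ E B) * M.freshLaw ν (σ t) (E' ×ˢ {j} ×ˢ B') := by
  have hupdate {E : ℕ → Set (Vec n)} (hE : ∀ r, MeasurableSet (E r)) {E' : Set (Vec n)}
      (hE' : MeasurableSet E') (r : ℕ) : MeasurableSet (Function.update E t E' r) := by
    obtain rfl | hr := eq_or_ne r t
    · simpa
    · simpa [hr] using hE r
  rw [cylinder_inter_preimage_fresh, measure_cylinder hM h hD _ _ (hupdate hE hE')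
    (hupdate hB hB'), measure_cylinder hM h hD t σ hE hB, Finset.prod_range_succ, mul_assoc]
  rw [Function.update_of_ne t.succ_pos.ne, Function.update_self, Function.update_self,
    Function.update_self, Function.update_of_ne t.lt_succ_self.ne]
  congr 2
  · refine Finset.prod_congr rfl fun r hr => ?_
    have hrt := Finset.mem_range.1 hr
    rw [Function.update_of_ne hrt.ne, Function.update_of_ne hrt.ne,
      Function.update_of_ne (by omega), Function.update_of_ne (by omega)]

theorem historyFiltration_le_generateFrom_cylinders (h : M.IsRealizedBy μ s w)
    (hD : IsPerturbation μ ν s w D) (t : ℕ) : historyFiltration h hD t ≤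
      MeasurableSpace.generateFrom (cylinders s w D t) := by
  set m := MeasurableSpace.generateFrom (cylinders s w D t)
  have hcyl (σ : ℕ → Fin K) {E B : ℕ → Set (Vec n)} (hE : ∀ r, MeasurableSet (E r))
      (hB : ∀ r, MeasurableSet (B r)) : MeasurableSet[m] (cylinder s w D t σ E B) :=
    MeasurableSpace.measurableSet_generateFrom ⟨σ, E, B, hE, hB, rfl⟩
  have hs (r : ℕ) (hr : r ≤ t) : Measurable[m] (s r) := fun I _ => by
    refine measurableSet_of_forall_inter_cylinder s w D t fun σ => ?_
    by_cases hσ : σ r ∈ I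
    · rw [Set.inter_eq_right.2 fun ω hω => by simpa [hω.2.1 r hr]]
      exact hcyl σ (fun _ => .univ) fun _ => .univ
    · rw [Set.disjoint_iff_inter_eq_empty.1 (Set.disjoint_left.2 fun ω hωI hω => hσ ?_)]
      · exact MeasurableSet.empty
      · simpa [hω.2.1 r hr] using hωI
  have hpi (r : ℕ) {E : Set (Vec n)} (hE : MeasurableSet E) (q : ℕ) :
      MeasurableSet {x | q = r → x ∈ E} := by
    by_cases hq : q = r <;> simp [hq, hE]
  have hDw (r : ℕ) (hr : r < t) : Measurable[m] (D r) ∧ Measurable[m] (w r) := by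
    constructor <;> refine fun E hE => measurableSet_of_forall_inter_cylinder s w D t fun σ => ?_
    · convert hcyl σ (hpi r hE) (fun _ => .univ) using 1
      ext ω
      simp only [cylinder, Set.mem_inter_iff, Set.mem_preimage, Set.mem_ofPred_eq]
      grind
    · convert hcyl σ (fun _ => .univ) (hpi r hE) using 1
      ext ω
      simp only [cylinder, Set.mem_inter_iff, Set.mem_preimage, Set.mem_ofPred_eq]
      grind
  exact sup_le (hs 0 t.zero_le).comap_le <| iSup₂_le fun r hr =>
    ((hDw r hr).1.prodMk ((hs (r + 1) hr).prodMk (hDw r hr).2)).comap_le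

theorem map_fresh_restrict_cylinder [IsProbabilityMeasure μ] [IsProbabilityMeasure ν]
    (hM : M.IsAdmissible) (h : M.IsRealizedBy μ s w) (hD : IsPerturbation μ ν s w D) (t : ℕ)
    (σ : ℕ → Fin K) {E B : ℕ → Set (Vec n)} (hE : ∀ r, MeasurableSet (E r))
    (hB : ∀ r, MeasurableSet (B r)) :
    (μ.restrict (cylinder s w D t σ E B)).map (fresh s w D t) =
      μ (cylinder s w D t σ E B) • M.freshLaw ν (σ t) := by
  refine ext_of_prod_singleton_prod fun E' j B' hE' hB' => ?_
  have hbox := hE'.prod ((measurableSet_singleton j).prod hB')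
  rw [Measure.map_apply (measurable_fresh h hD t) hbox,
    Measure.restrict_apply (measurable_fresh h hD t hbox), Set.inter_comm, Measure.smul_apply,
    smul_eq_mul, measure_cylinder_inter_preimage_fresh hM h hD t σ hE hB hE' hB']

theorem measure_cylinder_inter_state_inter_preimage_fresh [IsProbabilityMeasure μ]
    [IsProbabilityMeasure ν] (hM : M.IsAdmissible) (h : M.IsRealizedBy μ s w)
    (hD : IsPerturbation μ ν s w D) (t : ℕ) (i : Fin K) {A : Set Ω} (hA : A ∈ cylinders s w D t)
    {C : Set (Vec n × Fin K × Vec n)} (hC : MeasurableSet C) :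
    μ (A ∩ {ω | s t ω = i} ∩ fresh s w D t ⁻¹' C) =
      μ (A ∩ {ω | s t ω = i}) * M.freshLaw ν i C := by
  obtain ⟨σ, E, B, hE, hB, rfl⟩ := hA
  by_cases hσ : σ t = i
  · have hlaw := Measure.ext_iff.1 (map_fresh_restrict_cylinder hM h hD t σ hE hB) C hC
    rw [Measure.map_apply (measurable_fresh h hD t) hC,
      Measure.restrict_apply (measurable_fresh h hD t hC), Set.inter_comm, Measure.smul_apply,
      smul_eq_mul, hσ] at hlaw
    have hsub : cylinder s w D t σ E B ⊆ {ω | s t ω = i} :=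
      fun ω hω => (hω.2.1 t le_rfl).trans hσ
    rw [Set.inter_eq_left.2 hsub, hlaw]
  · have hempty : cylinder s w D t σ E B ∩ {ω | s t ω = i} = ∅ :=
      Set.eq_empty_of_forall_notMem fun ω hω => hσ ((hω.1.2.1 t le_rfl).symm.trans hω.2)
    simp [hempty]

theorem measurableSet_of_mem_cylinders (h : M.IsRealizedBy μ s w)
    (hD : IsPerturbation μ ν s w D) {t : ℕ} {A : Set Ω} (hA : A ∈ cylinders s w D t) :
    MeasurableSet A := by
  obtain ⟨σ, E, B, hE, hB, rfl⟩ := hA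
  have hs := h.measurable_state
  have hw := h.measurable_noise
  have hDm := hD.measurable
  unfold cylinder
  measurability

theorem eq_of_forall_mem_cylinders (h : M.IsRealizedBy μ s w) (hD : IsPerturbation μ ν s w D)
    {t : ℕ} {ρ₁ ρ₂ : Measure Ω} [IsFiniteMeasure ρ₁]
    (hρ : ∀ A ∈ cylinders s w D t, ρ₁ A = ρ₂ A) {A : Set Ω}
    (hA : MeasurableSet[historyFiltration h hD t] A) : ρ₁ A = ρ₂ A := by
  have hle : MeasurableSpace.generateFrom (cylinders s w D t) ≤ mΩ :=
    MeasurableSpace.generateFrom_le fun _ => measurableSet_of_mem_cylinders h hD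
  have htrim : ρ₁.trim hle = ρ₂.trim hle := by
    refine Measure.ext_of_generateFrom_of_cover_subset
      (T := Set.range fun σ : Fin (t + 1) → Fin K =>
        cylinder s w D t (extendPath σ) (fun _ => Set.univ) fun _ => Set.univ) rfl
      (isPiSystem_cylinders s w D t) ?_ (Set.countable_range _)
      (Set.sUnion_eq_univ_iff.2 fun ω => ⟨_, ⟨_, rfl⟩, mem_cylinder_extendPath t ω⟩)
      (fun _ _ => measure_ne_top _ _) fun S hS => ?_
    · rintro _ ⟨σ, rfl⟩
      exact ⟨_, _, _, fun _ => .univ, fun _ => .univ, rfl⟩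
    · have hSm := MeasurableSpace.measurableSet_generateFrom hS
      rw [trim_measurableSet_eq hle hSm, trim_measurableSet_eq hle hSm, hρ S hS]
  have hAm := historyFiltration_le_generateFrom_cylinders h hD t A hA
  rw [← trim_measurableSet_eq hle hAm, htrim, trim_measurableSet_eq hle hAm]

theorem measure_inter_preimage_fresh [IsProbabilityMeasure μ] [IsProbabilityMeasure ν]
    (hM : M.IsAdmissible) (h : M.IsRealizedBy μ s w) (hD : IsPerturbation μ ν s w D) (t : ℕ)
    (i : Fin K) {A : Set Ω} (hA : MeasurableSet[historyFiltration h hD t] A)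
    {C : Set (Vec n × Fin K × Vec n)} (hC : MeasurableSet C) :
    μ (A ∩ {ω | s t ω = i} ∩ fresh s w D t ⁻¹' C) =
      μ (A ∩ {ω | s t ω = i}) * M.freshLaw ν i C := by
  have heq := eq_of_forall_mem_cylinders h hD
    (ρ₁ := μ.restrict ({ω | s t ω = i} ∩ fresh s w D t ⁻¹' C))
    (ρ₂ := M.freshLaw ν i C • μ.restrict {ω | s t ω = i}) (fun A hA => ?_) hA
  · have hAm := (historyFiltration h hD).le t A hA
    rwa [Measure.smul_apply, Measure.restrict_apply hAm, Measure.restrict_apply hAm,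
      ← Set.inter_assoc, smul_eq_mul, mul_comm] at heq
  · have hAm := measurableSet_of_mem_cylinders h hD hA
    rw [Measure.smul_apply, Measure.restrict_apply hAm, Measure.restrict_apply hAm,
      ← Set.inter_assoc, smul_eq_mul, mul_comm,
      measure_cylinder_inter_state_inter_preimage_fresh hM h hD t i hA hC]

theorem setLIntegral_fresh [IsProbabilityMeasure μ] [IsProbabilityMeasure ν]
    (hM : M.IsAdmissible) (h : M.IsRealizedBy μ s w) (hD : IsPerturbation μ ν s w D) (t : ℕ)
    (i : Fin K) {A : Set Ω} (hA : MeasurableSet[historyFiltration h hD t] A) {𝓧 : Type*}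
    [MeasurableSpace 𝓧] {X : Ω → 𝓧} (hX : Measurable[historyFiltration h hD t] X)
    {φ : 𝓧 × (Vec n × Fin K × Vec n) → ENNReal} (hφ : Measurable φ) :
    ∫⁻ ω in A ∩ {ω | s t ω = i}, φ (X ω, fresh s w D t ω) ∂μ =
      ∫⁻ ω in A ∩ {ω | s t ω = i}, ∫⁻ u, φ (X ω, u) ∂M.freshLaw ν i ∂μ := by
  have := M.isProbabilityMeasure_freshLaw (ν := ν) hM i
  have hX' : Measurable X := hX.mono ((historyFiltration h hD).le t) le_rfl
  have hpair := hX'.prodMk (measurable_fresh h hD t)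
  have hjoint : (μ.restrict (A ∩ {ω | s t ω = i})).map (fun ω => (X ω, fresh s w D t ω)) =
      ((μ.restrict (A ∩ {ω | s t ω = i})).map X).prod (M.freshLaw ν i) := by
    refine Measure.ext_prod fun {S C} hS hC => ?_
    have hfree := measure_inter_preimage_fresh hM h hD t i (hA.inter (hX hS)) hC
    rw [Measure.map_apply hpair (hS.prod hC), Measure.restrict_apply (hpair (hS.prod hC)),
      Measure.prod_prod, Measure.map_apply hX' hS, Measure.restrict_apply (hX' hS),
      Set.inter_comm (X ⁻¹' S), Set.inter_right_comm A, ← hfree]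
    congr 1
    ext ω
    simp only [Set.mem_inter_iff, Set.mem_preimage, Set.mem_prod]
    tauto
  rw [← lintegral_map hφ hpair, hjoint, lintegral_prod _ hφ.aemeasurable,
    lintegral_map hφ.lintegral_prod_right' hX']

end Freshness

section Supermartingale

variable {Ω : Type*} {mΩ : MeasurableSpace Ω} {μ : Measure Ω} {Φ δ : ℕ → Ω → ENNReal}

theorem lintegral_add_sum_lintegral_le
    (hstep : ∀ t, ∫⁻ ω, Φ (t + 1) ω ∂μ + ∫⁻ ω, δ t ω ∂μ ≤ ∫⁻ ω, Φ t ω ∂μ) (t : ℕ) :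
    ∫⁻ ω, Φ t ω ∂μ + ∑ r ∈ Finset.range t, ∫⁻ ω, δ r ω ∂μ ≤ ∫⁻ ω, Φ 0 ω ∂μ := by
  induction t with
  | zero => simp
  | succ t ih =>
    rw [Finset.sum_range_succ, add_comm (∑ _ ∈ _, _), ← add_assoc]
    exact (add_le_add (hstep t) le_rfl).trans ih

theorem ae_tsum_ne_top_of_lintegral_succ_le (hδ : ∀ t, Measurable (δ t))
    (h0 : ∫⁻ ω, Φ 0 ω ∂μ ≠ ⊤)
    (hstep : ∀ t, ∫⁻ ω, Φ (t + 1) ω ∂μ + ∫⁻ ω, δ t ω ∂μ ≤ ∫⁻ ω, Φ t ω ∂μ) :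
    ∀ᵐ ω ∂μ, ∑' t, δ t ω ≠ ⊤ := by
  have hsum : ∫⁻ ω, ∑' t, δ t ω ∂μ ≠ ⊤ := by
    rw [lintegral_tsum fun t => (hδ t).aemeasurable]
    exact ne_top_of_le_ne_top h0 (ENNReal.tsum_le_of_sum_range_le fun t =>
      le_add_self.trans (lintegral_add_sum_lintegral_le hstep t))
  filter_upwards [ae_lt_top (Measurable.tsum hδ) hsum] with ω hω using hω.ne

theorem ae_exists_tendsto_toReal_of_setLIntegral_succ_le [IsFiniteMeasure μ]
    {ℱ : Filtration ℕ mΩ} (hΦ : ∀ t, Measurable[ℱ t] (Φ t)) (h0 : ∫⁻ ω, Φ 0 ω ∂μ ≠ ⊤)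
    (hstep : ∀ t A, MeasurableSet[ℱ t] A →
      ∫⁻ ω in A, Φ (t + 1) ω ∂μ ≤ ∫⁻ ω in A, Φ t ω ∂μ) :
    ∀ᵐ ω ∂μ, ∃ c : ℝ, Tendsto (fun t => (Φ t ω).toReal) atTop (𝓝 c) := by
  have hΦm : ∀ t, Measurable (Φ t) := fun t => (hΦ t).mono (ℱ.le t) le_rfl
  have hle : ∀ t, ∫⁻ ω, Φ t ω ∂μ ≤ ∫⁻ ω, Φ 0 ω ∂μ := fun t =>
    antitone_nat_of_succ_le (f := fun t => ∫⁻ ω, Φ t ω ∂μ) (fun t => by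
      simpa only [Measure.restrict_univ] using hstep t Set.univ MeasurableSet.univ) t.zero_le
  have hfin : ∀ t, ∫⁻ ω, Φ t ω ∂μ ≠ ⊤ := fun t => ne_top_of_le_ne_top h0 (hle t)
  have hset : ∀ t A, ∫ ω in A, (Φ t ω).toReal ∂μ = (∫⁻ ω in A, Φ t ω ∂μ).toReal := fun t A =>
    integral_toReal (hΦm t).aemeasurable (ae_restrict_of_ae (ae_lt_top (hΦm t) (hfin t)))
  have hsuper : Supermartingale (fun t ω => (Φ t ω).toReal) ℱ μ :=
    supermartingale_of_setIntegral_succ_le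
      (fun t => (hΦ t).ennreal_toReal.stronglyMeasurable)
      (fun t => integrable_toReal_of_lintegral_ne_top (hΦm t).aemeasurable (hfin t))
      fun t A hA => by
        rw [hset, hset]
        exact ENNReal.toReal_mono
          (ne_top_of_le_ne_top (hfin t) (setLIntegral_le_lintegral _ _)) (hstep t A hA)
  have hbdd : ∀ t, eLpNorm ((-fun t ω => (Φ t ω).toReal) t) 1 μ ≤
      ((∫⁻ ω, Φ 0 ω ∂μ).toNNReal : ENNReal) := fun t => by
    rw [Pi.neg_apply, eLpNorm_neg, eLpNorm_one_eq_lintegral_enorm, ENNReal.coe_toNNReal h0]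
    refine (lintegral_mono fun ω => ?_).trans (hle t)
    rw [Real.enorm_eq_ofReal ENNReal.toReal_nonneg]
    exact ENNReal.ofReal_toReal_le
  filter_upwards [hsuper.neg.exists_ae_tendsto_of_bdd hbdd] with ω hω
  obtain ⟨c, hc⟩ := hω
  exact ⟨-c, by simpa only [Pi.neg_apply, neg_neg] using hc.neg⟩

end Supermartingale

section Alternating

/-- At the visits `t ∈ vis` the flag `f` flips, and the counter `k`, which starts at zero, increases
whenever the flag is raised; nothing changes at the other times. -/
structure IsAlternating (vis : Set ℕ) (k : ℕ → ℕ) (f : ℕ → Bool) : Prop where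
  count_zero : k 0 = 0
  succ_of_notMem : ∀ t, t ∉ vis → k (t + 1) = k t ∧ f (t + 1) = f t
  succ_of_false : ∀ t, t ∈ vis → f t = false → k (t + 1) = k t + 1 ∧ f (t + 1) = true
  succ_of_true : ∀ t, t ∈ vis → f t = true → k (t + 1) = k t ∧ f (t + 1) = false

/-- The visits at which the flag is raised, that is, the first stages of the pairs. -/
def raises (vis : Set ℕ) (f : ℕ → Bool) : Set ℕ := {t | t ∈ vis ∧ f t = false}

namespace IsAlternating

variable {vis : Set ℕ} {k : ℕ → ℕ} {f : ℕ → Bool}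

theorem frequently_mem_raises (h : IsAlternating vis k f) (hvis : ∃ᶠ t in atTop, t ∈ vis) :
    ∃ᶠ t in atTop, t ∈ raises vis f := by
  intro hnot
  obtain ⟨N, hN⟩ := eventually_atTop.1 hnot
  have htrue : ∀ t ≥ N, t ∈ vis → f t = true := fun t ht hmem =>
    (Bool.not_eq_false _).mp fun hf => hN t ht ⟨hmem, hf⟩
  obtain ⟨t, htN, ht⟩ := frequently_atTop.1 hvis N
  have hfalse : ∀ r ≥ t + 1, f r = false := fun r hr => by
    induction r, hr using Nat.le_induction with
    | base => exact (h.succ_of_true t ht (htrue t htN ht)).2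
    | succ r hr ih =>
      have hr' : r ∉ vis := fun hmem => hN r (by omega) ⟨hmem, ih⟩
      exact (h.succ_of_notMem r hr').2.trans ih
  obtain ⟨r, hr, hmem⟩ := frequently_atTop.1 hvis (t + 1)
  exact hN r (by omega) ⟨hmem, hfalse r hr⟩

theorem count_succ_eq_ite (h : IsAlternating vis k f) (t : ℕ) [Decidable (t ∈ raises vis f)] :
    k (t + 1) = if t ∈ raises vis f then k t + 1 else k t := by
  split_ifs with ht
  · exact (h.succ_of_false t ht.1 ht.2).1
  · by_cases hmem : t ∈ vis
    · exact (h.succ_of_true t hmem ((Bool.not_eq_false _).mp fun hf => ht ⟨hmem, hf⟩)).1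
    · exact (h.succ_of_notMem t hmem).1

theorem tendsto_count_atTop (h : IsAlternating vis k f) (hvis : ∃ᶠ t in atTop, t ∈ vis) :
    Tendsto k atTop atTop := by
  classical
  have hmono : Monotone k := monotone_nat_of_le_succ fun t => by
    rw [h.count_succ_eq_ite]
    split_ifs <;> omega
  refine tendsto_atTop_atTop_of_monotone hmono fun b => ?_
  induction b with
  | zero => exact ⟨0, Nat.zero_le _⟩
  | succ b ih =>
    obtain ⟨t, ht⟩ := ih
    obtain ⟨r, hr, hmem⟩ := frequently_atTop.1 (h.frequently_mem_raises hvis) t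
    refine ⟨r + 1, ?_⟩
    rw [h.count_succ_eq_ite, if_pos hmem]
    exact Nat.succ_le_succ (ht.trans (hmono hr))

theorem sum_range_indicator_raises (h : IsAlternating vis k f) (α : ℕ → ℝ) (T : ℕ) :
    ∑ t ∈ Finset.range T, (raises vis f).indicator (fun t => α (k t)) t =
      ∑ m ∈ Finset.range (k T), α m := by
  classical
  induction T with
  | zero => simp [h.count_zero]
  | succ T ih =>
    rw [Finset.sum_range_succ, ih, h.count_succ_eq_ite, Set.indicator_apply]
    split_ifs
    · rw [Finset.sum_range_succ]
    · rw [add_zero]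

theorem not_summable_indicator_raises (h : IsAlternating vis k f)
    (hvis : ∃ᶠ t in atTop, t ∈ vis) {α : ℕ → ℝ} (hα : ∀ m, 0 ≤ α m) (hsum : ¬Summable α) :
    ¬Summable ((raises vis f).indicator fun t => α (k t)) := by
  rw [not_summable_iff_tendsto_nat_atTop_of_nonneg hα] at hsum
  intro hs
  have hlim := hs.hasSum.tendsto_sum_nat
  simp only [h.sum_range_indicator_raises] at hlim
  exact not_tendsto_nhds_of_tendsto_atTop (hsum.comp (h.tendsto_count_atTop hvis)) _ hlim

theorem limit_nonpos_of_summable_indicator_raises (h : IsAlternating vis k f)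
    (hvis : ∃ᶠ t in atTop, t ∈ vis) {α g : ℕ → ℝ} {c : ℝ} (hα : ∀ m, 0 ≤ α m)
    (hnot : ¬Summable α) (hg : Tendsto g atTop (𝓝 c))
    (hsum : Summable ((raises vis f).indicator fun t => α (k t) * g t)) : c ≤ 0 := by
  classical
  by_contra! hc
  refine h.not_summable_indicator_raises hvis hα hnot ?_
  refine (hsum.mul_left (2 / c)).of_norm_bounded_eventually_nat ?_
  filter_upwards [hg.eventually (lt_mem_nhds (half_lt_self hc))] with t ht
  rw [Real.norm_of_nonneg (Set.indicator_nonneg (fun _ _ => hα _) t), Set.indicator_apply,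
    Set.indicator_apply]
  split_ifs
  · calc α (k t) = 2 / c * (α (k t) * (c / 2)) := by field_simp
      _ ≤ 2 / c * (α (k t) * g t) := by gcongr; exact hα _
  · simp

theorem tendsto_of_eq_of_flag_false (h : IsAlternating vis k f)
    (hvis : ∃ᶠ t in atTop, t ∈ vis) {E : Type*} {v g : ℕ → E} {l : Filter E}
    (hv : ∀ t, ¬(t ∈ vis ∧ f t = true) → v (t + 1) = v t) (hgv : ∀ t, f t = false → g t = v t)
    (hg : Tendsto g atTop l) : Tendsto v atTop l := by
  intro U hU
  obtain ⟨N, hN⟩ := eventually_atTop.1 (hg.eventually hU)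
  have hfalse : ∀ t ≥ N, f t = false → v t ∈ U := fun t ht hf => hgv t hf ▸ hN t ht
  obtain ⟨T, hT, -, hfT⟩ := frequently_atTop.1 (h.frequently_mem_raises hvis) N
  refine eventually_atTop.2 ⟨T, fun t ht => ?_⟩
  induction t, ht using Nat.le_induction with
  | base => exact hfalse T hT hfT
  | succ t ht ih =>
    by_cases hflag : t ∈ vis ∧ f t = true
    · exact hfalse (t + 1) (by omega) (h.succ_of_true t hflag.1 hflag.2).2
    · exact (hv t hflag).symm ▸ ih

end IsAlternating

end Alternating

section StepSizes

variable {K n : ℕ} {p : Params K n}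

theorem Params.c_nonneg (hp : p.IsAdmissible) (i : Fin K) (k : ℕ) : 0 ≤ p.c i k := by
  have := hp.γ'_pos i
  unfold Params.c
  positivity

theorem Params.c_le (hp : p.IsAdmissible) (i : Fin K) (k : ℕ) : p.c i k ≤ p.γ' i := by
  have h0 := hp.γ'_pos i
  unfold Params.c
  rcases Nat.eq_zero_or_pos (p.N' i + k) with h | h
  · have hzero : (p.N' i : ℝ) + k = 0 := by exact_mod_cast h
    rw [hzero, Real.zero_rpow (by norm_num), div_zero]
    exact h0.le
  · have hone : (1 : ℝ) ≤ (p.N' i : ℝ) + k := by exact_mod_cast h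
    exact div_le_self h0.le (Real.one_le_rpow hone (by norm_num))

theorem Params.c_succ_pos (hp : p.IsAdmissible) (i : Fin K) (k : ℕ) : 0 < p.c i (k + 1) := by
  have := hp.γ'_pos i
  unfold Params.c
  positivity

theorem Params.a_nonneg (hp : p.IsAdmissible) (i : Fin K) (k : ℕ) : 0 ≤ p.a i k := by
  have := hp.γ_pos i
  unfold Params.a
  positivity

theorem Params.tendsto_c (p : Params K n) (i : Fin K) : Tendsto (p.c i) atTop (𝓝 0) :=
  tendsto_const_nhds.div_atTop ((tendsto_rpow_atTop (by norm_num)).comp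
    (tendsto_atTop_add_const_left _ _ tendsto_natCast_atTop_atTop))

theorem Params.not_summable_a (hp : p.IsAdmissible) (i : Fin K) :
    ¬Summable fun k => p.a i (k + 1) := by
  have h_eq : (fun k => p.a i (k + 1)) =
      fun k => p.γ i * (fun m : ℕ => (m : ℝ)⁻¹) (k + (p.N i + 1)) := by
    ext k
    simp only [Params.a, div_eq_mul_inv]
    push_cast
    ring_nf
  rw [h_eq, summable_mul_left_iff (hp.γ_pos i).ne']
  exact fun h => Real.not_summable_natCast_inv
    ((summable_nat_add_iff (f := fun m : ℕ => (m : ℝ)⁻¹) (p.N i + 1)).1 h)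

theorem Params.sq_a_div_c (p : Params K n) (i : Fin K) (k : ℕ) :
    (p.a i k / p.c i k) ^ 2 =
      (p.γ i / p.γ' i) ^ 2 * (((p.N' i : ℝ) + k) ^ (1 / 2 : ℝ) / ((p.N i : ℝ) + k) ^ 2) := by
  have hsqrt : ((p.N' i : ℝ) + k) ^ (1 / 2 : ℝ) = (((p.N' i : ℝ) + k) ^ (1 / 4 : ℝ)) ^ 2 := by
    rw [← Real.rpow_natCast, ← Real.rpow_mul (by positivity)]
    norm_num
  rw [hsqrt, Params.a, Params.c, div_div_div_eq, mul_comm (_ + _) (p.γ' i), mul_div_mul_comm,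
    mul_pow, div_pow (_ ^ _)]

theorem Params.summable_sq_a_div_c (p : Params K n) (i : Fin K) :
    Summable fun k => (p.a i (k + 1) / p.c i (k + 1)) ^ 2 := by
  have hsum : Summable fun k : ℕ => ((k + 1 : ℕ) : ℝ) ^ (-(3 / 2) : ℝ) :=
    (summable_nat_add_iff 1).2 (Real.summable_nat_rpow.2 (by norm_num))
  refine Summable.of_nonneg_of_le (fun k => sq_nonneg _) (fun k => ?_)
    (hsum.mul_left ((p.γ i / p.γ' i) ^ 2 * ((p.N' i : ℝ) + 1) ^ (1 / 2 : ℝ)))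
  rw [p.sq_a_div_c, mul_assoc]
  set x : ℝ := ((k + 1 : ℕ) : ℝ) with hx
  have hx1 : 1 ≤ x := by rw [hx]; exact_mod_cast k.succ_pos
  have hx0 : 0 < x := by linarith
  have hpow : ((p.N' i : ℝ) + 1) ^ (1 / 2 : ℝ) * x ^ (-(3 / 2) : ℝ) =
      (((p.N' i : ℝ) + 1) * x) ^ (1 / 2 : ℝ) / x ^ 2 := by
    rw [Real.mul_rpow (by positivity) hx0.le, mul_div_assoc, ← Real.rpow_natCast,
      ← Real.rpow_sub hx0]
    norm_num
  have hN' : (p.N' i : ℝ) + x ≤ ((p.N' i : ℝ) + 1) * x := by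
    nlinarith [(p.N' i).cast_nonneg (α := ℝ)]
  rw [hpow]
  gcongr
  exact le_add_of_nonneg_left (Nat.cast_nonneg _)

/-- The tail `∑_{m > k} C (a_m / c_m) ^ 2` of the series that bounds the total second-order effect
of the remaining updates. -/
noncomputable def Params.tail (p : Params K n) (C : ℝ) (i : Fin K) (k : ℕ) : ENNReal :=
  ∑' r, ENNReal.ofReal (C * (p.a i (r + k + 1) / p.c i (r + k + 1)) ^ 2)

theorem Params.tail_eq_add (p : Params K n) (C : ℝ) (i : Fin K) (k : ℕ) :
    p.tail C i k = ENNReal.ofReal (C * (p.a i (k + 1) / p.c i (k + 1)) ^ 2) +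
      p.tail C i (k + 1) := by
  unfold Params.tail
  rw [tsum_eq_zero_add' ENNReal.summable, zero_add]
  simp only [add_assoc, add_comm 1]

theorem Params.tail_zero_ne_top (p : Params K n) (C : ℝ) (i : Fin K) : p.tail C i 0 ≠ ⊤ :=
  ((p.summable_sq_a_div_c i).mul_left C).tsum_ofReal_ne_top

theorem Params.tail_ne_top (p : Params K n) (C : ℝ) (i : Fin K) (k : ℕ) : p.tail C i k ≠ ⊤ := by
  induction k with
  | zero => exact p.tail_zero_ne_top C i
  | succ k ih =>
    rw [p.tail_eq_add] at ih
    exact ne_top_of_le_ne_top ih le_add_self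

theorem Params.tendsto_toReal_tail (p : Params K n) (C : ℝ) (i : Fin K) :
    Tendsto (fun k => (p.tail C i k).toReal) atTop (𝓝 0) :=
  (ENNReal.tendsto_toReal ENNReal.zero_ne_top).comp
    (ENNReal.tendsto_sum_nat_add _ (p.tail_zero_ne_top C i))

end StepSizes

section MemoryStep

variable {K n : ℕ} {p : Params K n}

/-- The one-stage transition of the policy memory when the state `i` was observed; `u` consists of
the fresh perturbation, the next state and the noise. -/
noncomputable def Params.step (p : Params K n) (M : Model K n) (m : Memory K n) (i : Fin K)
    (u : Vec n × Fin K × Vec n) : Memory K n :=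
  p.update m i u.1 (M.output u.2.1 (p.input m i u.1) u.2.2)

theorem Params.step_of_flag_false (p : Params K n) (M : Model K n) {m : Memory K n} {i : Fin K}
    (h : m.flag i = false) (u : Vec n × Fin K × Vec n) :
    p.step M m i u = { m with
      count := Function.update m.count i (m.count i + 1)
      flag := Function.update m.flag i true
      pert := Function.update m.pert i u.1
      dplus := Function.update m.dplus i
        (M.cost (m.est i + p.c i (m.count i + 1) • u.1) u.2) } := by
  simp only [Params.step, Params.update, Params.input, if_pos h, Model.cost]

/-- The estimate of the state `i` that results from the pending update when the measurement at
`x̂ - c Δ` is `M.cost _ z`. -/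
noncomputable def Params.nextEst (p : Params K n) (M : Model K n) (m : Memory K n) (i : Fin K)
    (z : Fin K × Vec n) : Vec n :=
  spsaStep p.feasible (p.a i (m.count i)) (p.c i (m.count i)) (m.est i) (m.pert i)
    (m.dplus i - M.cost (m.est i - p.c i (m.count i) • m.pert i) z)

theorem Params.step_of_flag_true (p : Params K n) (M : Model K n) {m : Memory K n} {i : Fin K}
    (h : m.flag i = true) (u : Vec n × Fin K × Vec n) :
    p.step M m i u = { m with
      est := Function.update m.est i (p.nextEst M m i u.2)
      flag := Function.update m.flag i false } := by
  simp only [Params.step, Params.update, Params.input, h, Bool.true_eq_false, if_false,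
    Params.nextEst, Model.cost, spsaStep, recip]

instance : MeasurableSpace (Memory K n) :=
  MeasurableSpace.comap (fun m => (m.est, m.count, m.flag, m.pert, m.dplus)) inferInstance

theorem Memory.measurable_fields :
    Measurable fun m : Memory K n => (m.est, m.count, m.flag, m.pert, m.dplus) :=
  comap_measurable _

@[fun_prop]
theorem Memory.measurable_est : Measurable (Memory.est : Memory K n → _) :=
  Memory.measurable_fields.fst

@[fun_prop]
theorem Memory.measurable_count : Measurable (Memory.count : Memory K n → _) :=
  Memory.measurable_fields.snd.fst

@[fun_prop]
theorem Memory.measurable_flag : Measurable (Memory.flag : Memory K n → _) :=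
  Memory.measurable_fields.snd.snd.fst

@[fun_prop]
theorem Memory.measurable_pert : Measurable (Memory.pert : Memory K n → _) :=
  Memory.measurable_fields.snd.snd.snd.fst

@[fun_prop]
theorem Memory.measurable_dplus : Measurable (Memory.dplus : Memory K n → _) :=
  Memory.measurable_fields.snd.snd.snd.snd

theorem Memory.measurable_mk {α : Type*} [MeasurableSpace α] {est pert : α → Fin K → Vec n}
    {count : α → Fin K → ℕ} {flag : α → Fin K → Bool} {dplus : α → Fin K → ℝ}
    (hest : Measurable est) (hcount : Measurable count) (hflag : Measurable flag)
    (hpert : Measurable pert) (hdplus : Measurable dplus) :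
    Measurable fun x => Memory.mk (est x) (count x) (flag x) (pert x) (dplus x) :=
  measurable_comap_iff.2
    (hest.prodMk (hcount.prodMk (hflag.prodMk (hpert.prodMk hdplus))))

theorem Memory.measurableSet_flag_eq_false (i : Fin K) :
    MeasurableSet {m : Memory K n | m.flag i = false} :=
  (measurable_pi_apply i).comp Memory.measurable_flag (measurableSet_singleton false)

@[fun_prop]
theorem Params.measurable_a (p : Params K n) (i : Fin K) : Measurable (p.a i) :=
  measurable_of_countable _

@[fun_prop]
theorem Params.measurable_c (p : Params K n) (i : Fin K) : Measurable (p.c i) :=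
  measurable_of_countable _

theorem Params.measurable_input (p : Params K n) (i : Fin K) :
    Measurable fun q : Memory K n × Vec n => p.input q.1 i q.2 :=
  Measurable.ite (measurable_fst (Memory.measurableSet_flag_eq_false i))
    (by fun_prop) (by fun_prop)

theorem measurable_spsaStep {S : Set (Vec n)} (hc : Convex ℝ S) (hS : IsCompact S)
    (hne : S.Nonempty) {α : Type*} [MeasurableSpace α] {a c δ : α → ℝ} {x d : α → Vec n}
    (ha : Measurable a) (hcm : Measurable c) (hx : Measurable x) (hd : Measurable d)
    (hδ : Measurable δ) :
    Measurable fun q => spsaStep S (a q) (c q) (x q) (d q) (δ q) :=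
  (lipschitzWith_one_proj hc hS hne).continuous.measurable.comp (by fun_prop)

theorem Params.measurable_nextEst (hp : p.IsAdmissible) (M : Model K n) (i : Fin K) :
    Measurable fun q : Memory K n × Fin K × Vec n => p.nextEst M q.1 i q.2 :=
  measurable_spsaStep hp.convex hp.compact ⟨_, hp.init_mem i⟩ (by fun_prop) (by fun_prop)
    (by fun_prop) (by fun_prop) (by fun_prop)

theorem measurable_update_comp {α ι E : Type*} [MeasurableSpace α] [MeasurableSpace E]
    [DecidableEq ι] (i : ι) {f : α → ι → E} {g : α → E} (hf : Measurable f) (hg : Measurable g) :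
    Measurable fun x => Function.update (f x) i (g x) :=
  measurable_update'.comp (hf.prodMk hg)

theorem Params.measurable_step (hp : p.IsAdmissible) (M : Model K n) (i : Fin K) :
    Measurable fun q : Memory K n × Vec n × Fin K × Vec n => p.step M q.1 i q.2 := by
  have hinput := p.measurable_input i
  have hcost : Measurable fun q : Memory K n × Vec n × Fin K × Vec n =>
      M.cost (p.input q.1 i q.2.1) q.2.2 := by fun_prop
  have hest : Measurable fun q : Memory K n × Vec n × Fin K × Vec n =>
      spsaStep p.feasible (p.a i (q.1.count i)) (p.c i (q.1.count i)) (q.1.est i) (q.1.pert i)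
        (q.1.dplus i - M.cost (p.input q.1 i q.2.1) q.2.2) :=
    measurable_spsaStep hp.convex hp.compact ⟨_, hp.init_mem i⟩ (by fun_prop) (by fun_prop)
      (by fun_prop) (by fun_prop) (by fun_prop)
  exact Measurable.ite (measurable_fst (Memory.measurableSet_flag_eq_false i))
    (Memory.measurable_mk (by fun_prop) (measurable_update_comp i (by fun_prop) (by fun_prop))
      (measurable_update_comp i (by fun_prop) (by fun_prop))
      (measurable_update_comp i (by fun_prop) (by fun_prop))
      (measurable_update_comp i (by fun_prop) hcost))
    (Memory.measurable_mk (measurable_update_comp i (by fun_prop) hest) (by fun_prop)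
      (measurable_update_comp i (by fun_prop) (by fun_prop)) (by fun_prop) (by fun_prop))

end MemoryStep

section Lyapunov

variable {K n : ℕ} {p : Params K n} {M : Model K n}

/-- The mean square error of the estimate of the state `i` after its pending update, if there is
one; the mean is over the second measurement of the pair. -/
noncomputable def Params.meanSqError (p : Params K n) (M : Model K n) (i : Fin K)
    (m : Memory K n) : ENNReal :=
  if m.flag i = false then ENNReal.ofReal (‖m.est i - M.optimalInput i‖ ^ 2)
  else ∫⁻ z, ENNReal.ofReal (‖p.nextEst M m i z - M.optimalInput i‖ ^ 2) ∂M.nextLaw i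

/-- The Lyapunov function of the state `i`: adding the tail compensates the second-order terms of
all future updates. -/
noncomputable def Params.lyapunov (p : Params K n) (M : Model K n) (C : ℝ) (i : Fin K)
    (m : Memory K n) : ENNReal :=
  p.meanSqError M i m + p.tail C i (m.count i)

/-- A lower bound for the mean decrease of the Lyapunov function at a visit to the state `i`. -/
noncomputable def Params.decrease (p : Params K n) (M : Model K n) (b : ℝ) (i : Fin K)
    (m : Memory K n) : ENNReal :=
  if m.flag i = false then
    ENNReal.ofReal (b * p.a i (m.count i + 1) * ‖m.est i - M.optimalInput i‖ ^ 2)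
  else 0

theorem Params.lyapunov_step_of_ne (p : Params K n) (M : Model K n) (C : ℝ) {i j : Fin K}
    (hij : i ≠ j) (m : Memory K n) (u : Vec n × Fin K × Vec n) :
    p.lyapunov M C i (p.step M m j u) = p.lyapunov M C i m := by
  cases h : m.flag j
  · simp only [p.step_of_flag_false M h, Params.lyapunov, Params.meanSqError, Params.nextEst,
      Function.update_of_ne hij]
  · simp only [p.step_of_flag_true M h, Params.lyapunov, Params.meanSqError, Params.nextEst,
      Function.update_of_ne hij]

theorem Params.measurable_meanSqError (hp : p.IsAdmissible) (hM : M.IsAdmissible) (i : Fin K) :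
    Measurable (p.meanSqError M i) := by
  have := M.isProbabilityMeasure_nextLaw hM i
  have hest := p.measurable_nextEst hp M i
  exact Measurable.ite (Memory.measurableSet_flag_eq_false i) (by fun_prop)
    (Measurable.lintegral_prod_right'
      (f := fun q : Memory K n × Fin K × Vec n =>
        ENNReal.ofReal (‖p.nextEst M q.1 i q.2 - M.optimalInput i‖ ^ 2)) (by fun_prop))

theorem Params.measurable_lyapunov (hp : p.IsAdmissible) (hM : M.IsAdmissible) (C : ℝ)
    (i : Fin K) : Measurable (p.lyapunov M C i) := by
  have hmean := p.measurable_meanSqError hp hM i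
  have htail : Measurable (p.tail C i) := measurable_of_countable _
  unfold Params.lyapunov
  fun_prop

theorem Params.measurable_decrease (p : Params K n) (M : Model K n) (b : ℝ) (i : Fin K) :
    Measurable (p.decrease M b i) :=
  Measurable.ite (Memory.measurableSet_flag_eq_false i) (by fun_prop) measurable_const

theorem Params.meanSqError_step_of_flag_true (p : Params K n) (M : Model K n) {m : Memory K n}
    {i : Fin K} (h : m.flag i = true) (u : Vec n × Fin K × Vec n) :
    p.meanSqError M i (p.step M m i u) =
      ENNReal.ofReal (‖p.nextEst M m i u.2 - M.optimalInput i‖ ^ 2) := by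
  simp only [p.step_of_flag_true M h, Params.meanSqError, Function.update_self, if_true]

theorem Params.meanSqError_step_of_flag_false (p : Params K n) (M : Model K n) {m : Memory K n}
    {i : Fin K} (h : m.flag i = false) (d : Vec n) (z : Fin K × Vec n) :
    p.meanSqError M i (p.step M m i (d, z)) =
      ∫⁻ z', ENNReal.ofReal (‖spsaStep p.feasible (p.a i (m.count i + 1)) (p.c i (m.count i + 1))
        (m.est i) d (M.cost (m.est i + p.c i (m.count i + 1) • d) z
          - M.cost (m.est i - p.c i (m.count i + 1) • d) z') - M.optimalInput i‖ ^ 2)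
        ∂M.nextLaw i := by
  simp only [p.step_of_flag_false M h, Params.meanSqError, Params.nextEst, Function.update_self,
    Bool.true_eq_false, if_false]

theorem Params.lintegral_meanSqError_step_of_flag_true (hp : p.IsAdmissible)
    (hM : M.IsAdmissible) (ν : Measure ℝ) [IsProbabilityMeasure ν] {m : Memory K n} {i : Fin K}
    (h : m.flag i = true) :
    ∫⁻ u, p.meanSqError M i (p.step M m i u) ∂M.freshLaw ν i = p.meanSqError M i m := by
  have := M.isProbabilityMeasure_nextLaw hM i
  have hest := p.measurable_nextEst hp M i
  have hmeas : Measurable fun z =>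
      ENNReal.ofReal (‖p.nextEst M m i z - M.optimalInput i‖ ^ 2) := by fun_prop
  simp only [p.meanSqError_step_of_flag_true M h]
  simp only [Params.meanSqError, h, Bool.true_eq_false, if_false]
  exact (measurePreserving_snd (μ := vecLaw ν n) (ν := M.nextLaw i)).lintegral_comp hmeas

theorem Params.exists_lintegral_meanSqError_step_add_decrease_le (hp : p.IsAdmissible)
    (hM : M.IsAdmissible) {ν : Measure ℝ} {ξ₁ ξ₂ : ℝ} (hν : IsPerturbationLaw ν ξ₁ ξ₂) (i : Fin K)
    (ho : M.optimalInput i ∈ p.feasible) :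
    ∃ C b : ℝ, 0 < b ∧ ∀ m : Memory K n, m.est i ∈ p.feasible → m.flag i = false →
      ∫⁻ u, p.meanSqError M i (p.step M m i u) ∂M.freshLaw ν i + p.decrease M b i m ≤
        p.meanSqError M i m +
          ENNReal.ofReal (C * (p.a i (m.count i + 1) / p.c i (m.count i + 1)) ^ 2) := by
  have := hν.isProb
  have := M.isProbabilityMeasure_nextLaw hM i
  obtain ⟨l, hl, hgrad⟩ := M.exists_pos_mul_norm_sq_le_inner_costGradient hM i
  obtain ⟨r, hr⟩ := hp.compact.isBounded.exists_norm_le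
  obtain ⟨C, hC⟩ := M.exists_integral_sq_cost_le hM (p.γ' i * √(n * ξ₁ ^ 2) + r)
  refine ⟨4 * C * (n * max ξ₂ 0), 4 * l, by positivity, fun m hm h => ?_⟩
  have hmeas : Measurable fun u => p.meanSqError M i (p.step M m i u) :=
    (p.measurable_meanSqError hp hM i).comp
      ((p.measurable_step hp M i).comp (measurable_prodMk_left (x := m)))
  rw [Model.freshLaw, lintegral_prod _ hmeas.aemeasurable]
  simp only [p.meanSqError_step_of_flag_false M h]
  simp only [Params.decrease, Params.meanSqError, if_pos h]
  have hstep := lintegral_norm_spsaStep_sub_sq_add_le hν hp.convex hp.compact ho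
    (M.memLp_cost hM i) (x := m.est i) (p.a_nonneg hp i (m.count i + 1))
    (p.c_succ_pos hp i (m.count i)) (fun y hy => hC i y (by
      have hc := p.c_le hp i (m.count i + 1)
      calc ‖y‖ = ‖(y - m.est i) + m.est i‖ := by rw [sub_add_cancel]
        _ ≤ p.c i (m.count i + 1) * √(n * ξ₁ ^ 2) + r := norm_add_le_of_le hy (hr _ hm)
        _ ≤ p.γ' i * √(n * ξ₁ ^ 2) + r := by gcongr))
    (fun d => by
      rw [M.integral_cost hM, M.integral_cost hM]
      exact M.stageCost_add_sub_stageCost_sub hM i _ d _)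
    ((by positivity : (0 : ℝ) ≤ l * ‖m.est i - M.optimalInput i‖ ^ 2).trans (hgrad _))
  refine le_trans ?_ hstep
  gcongr ?_ + ENNReal.ofReal ?_
  · rfl
  · have := mul_le_mul_of_nonneg_left (hgrad (m.est i)) (p.a_nonneg hp i (m.count i + 1))
    linarith

theorem Params.exists_lintegral_lyapunov_step_add_decrease_le (hp : p.IsAdmissible)
    (hM : M.IsAdmissible) {ν : Measure ℝ} {ξ₁ ξ₂ : ℝ} (hν : IsPerturbationLaw ν ξ₁ ξ₂) (i : Fin K)
    (ho : M.optimalInput i ∈ p.feasible) :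
    ∃ C b : ℝ, 0 < b ∧ ∀ m : Memory K n, m.est i ∈ p.feasible →
      ∫⁻ u, p.lyapunov M C i (p.step M m i u) ∂M.freshLaw ν i + p.decrease M b i m ≤
        p.lyapunov M C i m := by
  have := hν.isProb
  have := M.isProbabilityMeasure_freshLaw (ν := ν) hM i
  obtain ⟨C, b, hb, hstep⟩ := p.exists_lintegral_meanSqError_step_add_decrease_le hp hM hν i ho
  refine ⟨C, b, hb, fun m hm => ?_⟩
  cases h : m.flag i
  · have hcount : ∀ u, (p.step M m i u).count i = m.count i + 1 := fun u => by
      simp only [p.step_of_flag_false M h, Function.update_self]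
    simp only [Params.lyapunov, hcount]
    rw [lintegral_add_right _ measurable_const, lintegral_const, measure_univ, mul_one,
      p.tail_eq_add C i (m.count i), ← add_assoc, add_right_comm]
    exact add_le_add (hstep m hm h) le_rfl
  · have hcount : ∀ u, (p.step M m i u).count i = m.count i := fun u => by
      rw [p.step_of_flag_true M h]
    simp only [Params.lyapunov, hcount, Params.decrease, h, Bool.true_eq_false, if_false, add_zero]
    rw [lintegral_add_right _ measurable_const, lintegral_const, measure_univ, mul_one,
      p.lintegral_meanSqError_step_of_flag_true hp hM ν h]

end Lyapunov

theorem tendsto_of_forall_tendsto_inf_principal {α ι X : Type*} [Finite ι] {σ : α → ι}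
    {l : Filter α} {l' : Filter X} {f : α → X}
    (h : ∀ i, Tendsto f (l ⊓ 𝓟 (σ ⁻¹' {i})) l') : Tendsto f l l' := by
  intro U hU
  have hall := eventually_all.2 fun i => eventually_inf_principal.1 (h i hU)
  exact mem_map.2 (hall.mono fun x hx => hx (σ x) rfl)

section Path

variable {K n : ℕ} {p : Params K n} {M : Model K n} {s : ℕ → Fin K} {w D : ℕ → Vec n} {ρ : ℝ}

theorem Params.run_succ (p : Params K n) (M : Model K n) (s : ℕ → Fin K) (w D : ℕ → Vec n)
    (t : ℕ) : p.run M s w D (t + 1) = p.step M (p.run M s w D t) (s t) (D t, s (t + 1), w t) :=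
  rfl

theorem Params.est_run_mem (hp : p.IsAdmissible) (M : Model K n) (s : ℕ → Fin K)
    (w D : ℕ → Vec n) (t : ℕ) (i : Fin K) : (p.run M s w D t).est i ∈ p.feasible := by
  induction t with
  | zero => exact hp.init_mem i
  | succ t ih =>
    rw [p.run_succ]
    cases hf : (p.run M s w D t).flag (s t)
    · rw [p.step_of_flag_false M hf]
      exact ih
    · rw [p.step_of_flag_true M hf]
      dsimp only
      rw [Function.update_apply]
      split_ifs
      · exact proj_mem hp.compact ⟨_, hp.init_mem i⟩ _
      · exact ih

theorem Params.norm_pert_run_le (p : Params K n) (M : Model K n) (s : ℕ → Fin K) (w : ℕ → Vec n)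
    (hD : ∀ t, ‖D t‖ ≤ ρ) (t : ℕ) (i : Fin K) : ‖(p.run M s w D t).pert i‖ ≤ ρ := by
  induction t with
  | zero => exact norm_zero.trans_le ((norm_nonneg _).trans (hD 0))
  | succ t ih =>
    rw [p.run_succ]
    cases hf : (p.run M s w D t).flag (s t)
    · rw [p.step_of_flag_false M hf]
      dsimp only
      rw [Function.update_apply]
      split_ifs
      · exact hD t
      · exact ih
    · rw [p.step_of_flag_true M hf]
      exact ih

theorem Params.norm_input_sub_le (hp : p.IsAdmissible) {m : Memory K n} {i : Fin K} {d : Vec n}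
    (hm : ‖m.pert i‖ ≤ ρ) (hd : ‖d‖ ≤ ρ) (o : Vec n) :
    ‖p.input m i d - o‖ ≤ ‖m.est i - o‖ + (p.c i (m.count i) + p.c i (m.count i + 1)) * ρ := by
  have hρ : 0 ≤ ρ := (norm_nonneg _).trans hd
  have hc := p.c_nonneg hp i
  have hsmul : ∀ k (v : Vec n), ‖v‖ ≤ ρ → ‖p.c i k • v‖ ≤ p.c i k * ρ := fun k v hv => by
    rw [norm_smul, Real.norm_of_nonneg (hc k)]
    exact mul_le_mul_of_nonneg_left hv (hc k)
  rw [add_mul]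
  unfold Params.input
  split_ifs
  · rw [add_sub_right_comm]
    refine norm_add_le_of_le le_rfl ((hsmul _ d hd).trans ?_)
    exact le_add_of_nonneg_left (mul_nonneg (hc _) hρ)
  · rw [sub_right_comm]
    refine norm_sub_le_of_le le_rfl ((hsmul _ _ hm).trans ?_)
    exact le_add_of_nonneg_right (mul_nonneg (hc _) hρ)

theorem Params.norm_inputAt_sub_le (hp : p.IsAdmissible) (M : Model K n) (s : ℕ → Fin K)
    (w : ℕ → Vec n) (hD : ∀ t, ‖D t‖ ≤ ρ) (t : ℕ) (o : Vec n) :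
    ‖p.inputAt M s w D t - o‖ ≤ ‖(p.run M s w D t).est (s t) - o‖ +
      (p.c (s t) ((p.run M s w D t).count (s t)) +
        p.c (s t) ((p.run M s w D t).count (s t) + 1)) * ρ :=
  p.norm_input_sub_le hp (p.norm_pert_run_le M s w hD t (s t)) (hD t) o

theorem Params.exists_norm_inputAt_sub_le (hp : p.IsAdmissible) (M : Model K n) (ρ : ℝ) :
    ∃ B, ∀ (s : ℕ → Fin K) (w D : ℕ → Vec n), (∀ t, ‖D t‖ ≤ ρ) → ∀ t, ∀ o ∈ p.feasible,
      ‖p.inputAt M s w D t - o‖ ≤ B := by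
  obtain ⟨r, hr⟩ := hp.compact.isBounded.exists_norm_le
  refine ⟨r + r + (∑ i, p.γ' i + ∑ i, p.γ' i) * ρ, fun s w D hD t o ho => ?_⟩
  have hρ : 0 ≤ ρ := (norm_nonneg _).trans (hD 0)
  have hc : ∀ i k, p.c i k ≤ ∑ i, p.γ' i := fun i k => (p.c_le hp i k).trans
    (Finset.single_le_sum (fun i _ => (hp.γ'_pos i).le) (Finset.mem_univ i))
  refine (p.norm_inputAt_sub_le hp M s w hD t o).trans ?_
  gcongr
  · exact norm_sub_le_of_le (hr _ (p.est_run_mem hp M s w D t (s t))) (hr _ ho)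
  · exact hc _ _
  · exact hc _ _

theorem Params.isAlternating_run (p : Params K n) (M : Model K n) (s : ℕ → Fin K)
    (w D : ℕ → Vec n) (i : Fin K) :
    IsAlternating {t | s t = i} (fun t => (p.run M s w D t).count i)
      (fun t => (p.run M s w D t).flag i) where
  count_zero := rfl
  succ_of_notMem t ht := by
    have hi : i ≠ s t := Ne.symm ht
    cases hf : (p.run M s w D t).flag (s t)
    · simp only [p.run_succ, p.step_of_flag_false M hf, Function.update_of_ne hi, and_self]
    · simp only [p.run_succ, p.step_of_flag_true M hf, Function.update_of_ne hi, and_self]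
  succ_of_false t ht hf := by
    obtain rfl : s t = i := ht
    simp only [p.run_succ, p.step_of_flag_false M hf, Function.update_self, and_self]
  succ_of_true t ht hf := by
    obtain rfl : s t = i := ht
    simp only [p.run_succ, p.step_of_flag_true M hf, Function.update_self, and_self]

theorem Params.est_run_succ (p : Params K n) (M : Model K n) (w D : ℕ → Vec n) {i : Fin K} {t : ℕ}
    (ht : ¬(t ∈ {t | s t = i} ∧ (p.run M s w D t).flag i = true)) :
    (p.run M s w D (t + 1)).est i = (p.run M s w D t).est i := by
  rw [p.run_succ]
  cases hf : (p.run M s w D t).flag (s t)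
  · rw [p.step_of_flag_false M hf]
  · rw [p.step_of_flag_true M hf]
    exact Function.update_of_ne (fun hi => ht ⟨hi.symm, hi ▸ hf⟩) _ _

theorem Params.toReal_lyapunov_sub_tail (p : Params K n) (M : Model K n) (C : ℝ) {i : Fin K}
    {m : Memory K n} (h : m.flag i = false) :
    (p.lyapunov M C i m).toReal - (p.tail C i (m.count i)).toReal =
      ‖m.est i - M.optimalInput i‖ ^ 2 := by
  rw [Params.lyapunov, Params.meanSqError, if_pos h,
    ENNReal.toReal_add ENNReal.ofReal_ne_top (p.tail_ne_top C i _), add_sub_cancel_right,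
    ENNReal.toReal_ofReal (sq_nonneg _)]

theorem Params.toReal_decrease (hp : p.IsAdmissible) (M : Model K n) {b : ℝ} (hb : 0 ≤ b)
    (i : Fin K) (m : Memory K n) :
    (p.decrease M b i m).toReal = if m.flag i = false then
      b * p.a i (m.count i + 1) * ‖m.est i - M.optimalInput i‖ ^ 2 else 0 := by
  have ha := p.a_nonneg hp i (m.count i + 1)
  unfold Params.decrease
  split_ifs
  · exact ENNReal.toReal_ofReal (by positivity)
  · exact ENNReal.toReal_zero

theorem Params.tendsto_est_run (hp : p.IsAdmissible) {C b c : ℝ} (hb : 0 < b) {i : Fin K}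
    (hvis : ∃ᶠ t in atTop, t ∈ {t | s t = i})
    (hlim : Tendsto (fun t => (p.lyapunov M C i (p.run M s w D t)).toReal) atTop (𝓝 c))
    (hdec : ∑' t, {t | s t = i}.indicator (fun t => p.decrease M b i (p.run M s w D t)) t ≠ ⊤) :
    Tendsto (fun t => (p.run M s w D t).est i) atTop (𝓝 (M.optimalInput i)) := by
  classical
  set m := p.run M s w D
  have halt : IsAlternating {t | s t = i} (fun t => (m t).count i) fun t => (m t).flag i :=
    p.isAlternating_run M s w D i
  have hg : Tendsto (fun t => (p.lyapunov M C i (m t)).toReal -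
      (p.tail C i ((m t).count i)).toReal) atTop (𝓝 c) := by
    simpa only [sub_zero, Function.comp_def] using
      hlim.sub ((p.tendsto_toReal_tail C i).comp (halt.tendsto_count_atTop hvis))
  have hgv := fun t (ht : (m t).flag i = false) => p.toReal_lyapunov_sub_tail M C ht
  have hc : c ≤ 0 := by
    refine halt.limit_nonpos_of_summable_indicator_raises hvis (α := fun k => b * p.a i (k + 1))
      (fun k => mul_nonneg hb.le (p.a_nonneg hp i _))
      (fun h => p.not_summable_a hp i ((summable_mul_left_iff hb.ne').1 h)) hg
      ((ENNReal.summable_toReal hdec).congr fun t => ?_)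
    simp only [Set.indicator_apply, raises, Set.mem_ofPred_eq, ite_and]
    split_ifs with ht hf
    · rw [p.toReal_decrease hp M hb.le, if_pos hf, hgv t hf]
    · rw [p.toReal_decrease hp M hb.le, if_neg hf]
    · rfl
  obtain rfl : c = 0 := hc.antisymm (ge_of_tendsto' hlim fun _ => ENNReal.toReal_nonneg)
  have hsq : Tendsto (fun t => ‖(m t).est i - M.optimalInput i‖ ^ 2) atTop (𝓝 0) :=
    halt.tendsto_of_eq_of_flag_false hvis
      (fun t ht => by rw [p.est_run_succ M w D ht]) hgv hg
  rw [tendsto_iff_norm_sub_tendsto_zero]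
  simpa only [Real.sqrt_sq (norm_nonneg _), Real.sqrt_zero] using hsq.sqrt

theorem Params.tendsto_inputAt_sub (hp : p.IsAdmissible) {C b c : ℝ} (hb : 0 < b)
    (hD : ∀ t, ‖D t‖ ≤ ρ) {i : Fin K}
    (hlim : Tendsto (fun t => (p.lyapunov M C i (p.run M s w D t)).toReal) atTop (𝓝 c))
    (hdec : ∑' t, {t | s t = i}.indicator (fun t => p.decrease M b i (p.run M s w D t)) t ≠ ⊤) :
    Tendsto (fun t => p.inputAt M s w D t - M.optimalInput (s t)) (atTop ⊓ 𝓟 (s ⁻¹' {i}))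
      (𝓝 0) := by
  by_cases hvis : ∃ᶠ t in atTop, t ∈ {t | s t = i}
  · have hest := tendsto_iff_norm_sub_tendsto_zero.1 (p.tendsto_est_run hp hb hvis hlim hdec)
    have hcount := (p.isAlternating_run M s w D i).tendsto_count_atTop hvis
    have hbound := hest.add ((((p.tendsto_c i).comp hcount).add
      ((p.tendsto_c i).comp ((tendsto_add_atTop_nat 1).comp hcount))).mul_const ρ)
    simp only [add_zero, zero_mul] at hbound
    refine squeeze_zero_norm' (eventually_inf_principal.2 (.of_forall fun t ht => ?_))
      (hbound.mono_left inf_le_left)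
    obtain rfl : s t = i := ht
    exact p.norm_inputAt_sub_le hp M s w hD t _
  · exact tendsto_bot.mono_left (inf_principal_eq_bot.2 (not_frequently.1 hvis)).le

end Path

section Policy

variable {K n : ℕ} {p : Params K n} {M : Model K n} {Ω : Type*}

/-- The memory of the policy after `t` stages, as a random variable. -/
noncomputable def Params.memoryAt (p : Params K n) (M : Model K n) (s : ℕ → Ω → Fin K)
    (w D : ℕ → Ω → Vec n) (t : ℕ) (ω : Ω) : Memory K n :=
  p.run M (fun r => s r ω) (fun r => w r ω) (fun r => D r ω) t

theorem Params.memoryAt_succ (p : Params K n) (M : Model K n) (s : ℕ → Ω → Fin K)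
    (w D : ℕ → Ω → Vec n) (t : ℕ) (ω : Ω) : p.memoryAt M s w D (t + 1) ω =
      p.step M (p.memoryAt M s w D t ω) (s t ω) (fresh s w D t ω) :=
  rfl

variable {mΩ : MeasurableSpace Ω} {μ : Measure Ω} {ν : Measure ℝ} {s : ℕ → Ω → Fin K}
  {w D : ℕ → Ω → Vec n}

theorem Params.measurable_memoryAt_historyFiltration (hp : p.IsAdmissible) (M : Model K n)
    (h : M.IsRealizedBy μ s w) (hD : IsPerturbation μ ν s w D) (t : ℕ) :
    Measurable[historyFiltration h hD t] (p.memoryAt M s w D t) := by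
  induction t with
  | zero => exact measurable_const
  | succ t ih =>
    have hle := (historyFiltration h hD).mono t.le_succ
    have hstep : Measurable fun q : Fin K × (Memory K n × Vec n × Fin K × Vec n) =>
        p.step M q.2.1 q.1 q.2.2 :=
      measurable_from_prod_countable_right fun i => p.measurable_step hp M i
    exact hstep.comp (((measurable_state_historyFiltration h hD t).mono hle le_rfl).prodMk
      ((ih.mono hle le_rfl).prodMk (measurable_fresh_historyFiltration h hD t)))

theorem Params.measurable_memoryAt (hp : p.IsAdmissible) (M : Model K n)
    (h : M.IsRealizedBy μ s w) (hD : IsPerturbation μ ν s w D) (t : ℕ) :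
    Measurable (p.memoryAt M s w D t) :=
  (p.measurable_memoryAt_historyFiltration hp M h hD t).mono
    ((historyFiltration h hD).le t) le_rfl

theorem Params.measurable_inputAt (hp : p.IsAdmissible) (M : Model K n)
    (h : M.IsRealizedBy μ s w) (hD : IsPerturbation μ ν s w D) (t : ℕ) :
    Measurable fun ω =>
      p.inputAt M (fun r => s r ω) (fun r => w r ω) (fun r => D r ω) t := by
  have hinput : Measurable fun q : Fin K × (Memory K n × Vec n) => p.input q.2.1 q.1 q.2.2 :=
    measurable_from_prod_countable_right fun i => p.measurable_input i
  exact hinput.comp ((h.measurable_state t).prodMk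
    ((p.measurable_memoryAt hp M h hD t).prodMk (hD.measurable t)))

theorem IsPerturbation.ae_forall_norm_le [IsProbabilityMeasure μ]
    (hD : IsPerturbation μ ν s w D) {ξ₁ ξ₂ : ℝ} (hν : IsPerturbationLaw ν ξ₁ ξ₂) :
    ∀ᵐ ω ∂μ, ∀ t, ‖D t ω‖ ≤ √(n * ξ₁ ^ 2) :=
  ae_all_iff.2 fun t => ae_of_ae_map (hD.measurable t).aemeasurable
    (hD.map_eq t ▸ hν.ae_norm_le)

variable [IsProbabilityMeasure μ] {C b : ℝ} {i : Fin K}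

theorem Params.setLIntegral_lyapunov_visit_le [IsProbabilityMeasure ν] (hp : p.IsAdmissible)
    (hM : M.IsAdmissible)
    (h : M.IsRealizedBy μ s w) (hD : IsPerturbation μ ν s w D)
    (hstep : ∀ m : Memory K n, m.est i ∈ p.feasible →
      ∫⁻ u, p.lyapunov M C i (p.step M m i u) ∂M.freshLaw ν i + p.decrease M b i m ≤
        p.lyapunov M C i m)
    (t : ℕ) {A : Set Ω} (hA : MeasurableSet[historyFiltration h hD t] A) :
    ∫⁻ ω in A ∩ {ω | s t ω = i}, p.lyapunov M C i (p.memoryAt M s w D (t + 1) ω) ∂μ +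
        ∫⁻ ω in A ∩ {ω | s t ω = i}, p.decrease M b i (p.memoryAt M s w D t ω) ∂μ ≤
      ∫⁻ ω in A ∩ {ω | s t ω = i}, p.lyapunov M C i (p.memoryAt M s w D t ω) ∂μ := by
  have hi : MeasurableSet {ω | s t ω = i} := h.measurable_state t (measurableSet_singleton i)
  have hin := ((historyFiltration h hD).le t A hA).inter hi
  have hdec : Measurable fun ω => p.decrease M b i (p.memoryAt M s w D t ω) :=
    (p.measurable_decrease M b i).comp (p.measurable_memoryAt hp M h hD t)
  have hnext : ∫⁻ ω in A ∩ {ω | s t ω = i}, p.lyapunov M C i (p.memoryAt M s w D (t + 1) ω) ∂μ =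
      ∫⁻ ω in A ∩ {ω | s t ω = i}, ∫⁻ u, p.lyapunov M C i
        (p.step M (p.memoryAt M s w D t ω) i u) ∂M.freshLaw ν i ∂μ := by
    rw [← setLIntegral_fresh hM h hD t i hA (p.measurable_memoryAt_historyFiltration hp M h hD t)
      (φ := fun q => p.lyapunov M C i (p.step M q.1 i q.2))
      ((p.measurable_lyapunov hp hM C i).comp (p.measurable_step hp M i))]
    refine setLIntegral_congr_fun hin fun ω hω => ?_
    obtain rfl : s t ω = i := hω.2
    rfl
  rw [hnext, ← lintegral_add_right _ hdec]
  exact lintegral_mono fun ω => hstep _ (p.est_run_mem hp M _ _ _ t i)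

theorem Params.setLIntegral_lyapunov_succ_add_decrease_le [IsProbabilityMeasure ν]
    (hp : p.IsAdmissible)
    (hM : M.IsAdmissible) (h : M.IsRealizedBy μ s w) (hD : IsPerturbation μ ν s w D)
    (hstep : ∀ m : Memory K n, m.est i ∈ p.feasible →
      ∫⁻ u, p.lyapunov M C i (p.step M m i u) ∂M.freshLaw ν i + p.decrease M b i m ≤
        p.lyapunov M C i m)
    (t : ℕ) {A : Set Ω} (hA : MeasurableSet[historyFiltration h hD t] A) :
    ∫⁻ ω in A, p.lyapunov M C i (p.memoryAt M s w D (t + 1) ω) ∂μ +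
        ∫⁻ ω in A, {ω | s t ω = i}.indicator
          (fun ω => p.decrease M b i (p.memoryAt M s w D t ω)) ω ∂μ ≤
      ∫⁻ ω in A, p.lyapunov M C i (p.memoryAt M s w D t ω) ∂μ := by
  have hi : MeasurableSet {ω | s t ω = i} := h.measurable_state t (measurableSet_singleton i)
  have hout : ∫⁻ ω in A \ {ω | s t ω = i}, p.lyapunov M C i (p.memoryAt M s w D (t + 1) ω) ∂μ =
      ∫⁻ ω in A \ {ω | s t ω = i}, p.lyapunov M C i (p.memoryAt M s w D t ω) ∂μ :=
    setLIntegral_congr_fun (((historyFiltration h hD).le t A hA).diff hi) fun ω hω =>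
      by rw [p.memoryAt_succ, p.lyapunov_step_of_ne M C (Ne.symm hω.2)]
  rw [← lintegral_inter_add_sdiff _ A hi, hout, setLIntegral_indicator hi, Set.inter_comm _ A,
    add_right_comm, ← lintegral_inter_add_sdiff
      (fun ω => p.lyapunov M C i (p.memoryAt M s w D t ω)) A hi]
  exact add_le_add (p.setLIntegral_lyapunov_visit_le hp hM h hD hstep t hA) le_rfl

theorem Params.lintegral_lyapunov_memoryAt_zero_ne_top (p : Params K n) (M : Model K n) (C : ℝ)
    (i : Fin K) (s : ℕ → Ω → Fin K) (w D : ℕ → Ω → Vec n) :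
    ∫⁻ ω, p.lyapunov M C i (p.memoryAt M s w D 0 ω) ∂μ ≠ ⊤ := by
  have hstart : ∀ ω, p.lyapunov M C i (p.memoryAt M s w D 0 ω) =
      ENNReal.ofReal (‖p.init i - M.optimalInput i‖ ^ 2) + p.tail C i 0 := fun _ => rfl
  simp only [hstart, lintegral_const, measure_univ, mul_one]
  exact ENNReal.add_ne_top.2 ⟨ENNReal.ofReal_ne_top, p.tail_zero_ne_top C i⟩

theorem Params.ae_tendsto_inputAt_sub_of_state (hp : p.IsAdmissible) (hM : M.IsAdmissible)
    {ξ₁ ξ₂ : ℝ} (hν : IsPerturbationLaw ν ξ₁ ξ₂) (h : M.IsRealizedBy μ s w)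
    (hD : IsPerturbation μ ν s w D) (i : Fin K) (ho : M.optimalInput i ∈ p.feasible) :
    ∀ᵐ ω ∂μ, Tendsto (fun t =>
      p.inputAt M (fun r => s r ω) (fun r => w r ω) (fun r => D r ω) t - M.optimalInput (s t ω))
      (atTop ⊓ 𝓟 ((fun t => s t ω) ⁻¹' {i})) (𝓝 0) := by
  have := hν.isProb
  obtain ⟨C, b, hb, hstep⟩ := p.exists_lintegral_lyapunov_step_add_decrease_le hp hM hν i ho
  have hstart := p.lintegral_lyapunov_memoryAt_zero_ne_top (μ := μ) M C i s w D
  have hsuper := fun t A (hA : MeasurableSet[historyFiltration h hD t] A) =>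
    p.setLIntegral_lyapunov_succ_add_decrease_le hp hM h hD hstep t hA
  have hlim := ae_exists_tendsto_toReal_of_setLIntegral_succ_le
    (fun t => (p.measurable_lyapunov hp hM C i).comp
      (p.measurable_memoryAt_historyFiltration hp M h hD t))
    hstart fun t A hA => le_self_add.trans (hsuper t A hA)
  have hdec := ae_tsum_ne_top_of_lintegral_succ_le (μ := μ)
    (δ := fun t => {ω | s t ω = i}.indicator fun ω => p.decrease M b i (p.memoryAt M s w D t ω))
    (fun t => ((p.measurable_decrease M b i).comp (p.measurable_memoryAt hp M h hD t)).indicator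
      (h.measurable_state t (measurableSet_singleton i)))
    hstart fun t => by
      simpa only [Measure.restrict_univ] using hsuper t Set.univ MeasurableSet.univ
  filter_upwards [hlim, hdec, hD.ae_forall_norm_le hν] with ω ⟨c, hc⟩ hω hbound
  exact p.tendsto_inputAt_sub hp hb hbound hc hω

theorem Params.ae_tendsto_inputAt_sub (hp : p.IsAdmissible) (hM : M.IsAdmissible)
    {ξ₁ ξ₂ : ℝ} (hν : IsPerturbationLaw ν ξ₁ ξ₂) (h : M.IsRealizedBy μ s w)
    (hD : IsPerturbation μ ν s w D) (ho : ∀ i, M.optimalInput i ∈ p.feasible) :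
    ∀ᵐ ω ∂μ, Tendsto (fun t =>
      p.inputAt M (fun r => s r ω) (fun r => w r ω) (fun r => D r ω) t - M.optimalInput (s t ω))
      atTop (𝓝 0) := by
  filter_upwards [ae_all_iff.2 fun i =>
    p.ae_tendsto_inputAt_sub_of_state hp hM hν h hD i (ho i)] with ω hω
  exact tendsto_of_forall_tendsto_inf_principal hω

end Policy

end MarkovJump

theorem mainTheorem7 {K n : ℕ} (M : MarkovJump.Model K n) (hM : M.IsAdmissible)
    (p : MarkovJump.Params K n) (hp : p.IsAdmissible)
    (hopt : ∀ i, M.optimalInput i ∈ p.feasible)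
    (ν : Measure ℝ) (ξ₁ ξ₂ : ℝ) (hν : MarkovJump.IsPerturbationLaw ν ξ₁ ξ₂)
    {Ω : Type*} [MeasurableSpace Ω] (μ : Measure Ω) [IsProbabilityMeasure μ]
    (s : ℕ → Ω → Fin K) (w D : ℕ → Ω → MarkovJump.Vec n)
    (hsw : M.IsRealizedBy μ s w) (hD : MarkovJump.IsPerturbation μ ν s w D) :
    (∀ᵐ ω ∂μ, Tendsto
      (fun t => ‖p.inputAt M (fun r => s r ω) (fun r => w r ω) (fun r => D r ω) t
        - M.optimalInput (s t ω)‖ ^ 2) atTop (𝓝 0)) ∧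
    (∀ t, Integrable
      (fun ω => ‖p.inputAt M (fun r => s r ω) (fun r => w r ω) (fun r => D r ω) t
        - M.optimalInput (s t ω)‖ ^ 2) μ) ∧
    Tendsto
      (fun t => ∫ ω, ‖p.inputAt M (fun r => s r ω) (fun r => w r ω) (fun r => D r ω) t
        - M.optimalInput (s t ω)‖ ^ 2 ∂μ) atTop (𝓝 0) := by
  have hlim : ∀ᵐ ω ∂μ, Tendsto
      (fun t => ‖p.inputAt M (fun r => s r ω) (fun r => w r ω) (fun r => D r ω) t
        - M.optimalInput (s t ω)‖ ^ 2) atTop (𝓝 0) := by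
    filter_upwards [p.ae_tendsto_inputAt_sub hp hM hν hsw hD hopt] with ω hω
    simpa only [norm_zero, zero_pow two_ne_zero] using hω.norm.pow 2
  have hmeas : ∀ t, AEStronglyMeasurable
      (fun ω => ‖p.inputAt M (fun r => s r ω) (fun r => w r ω) (fun r => D r ω) t
        - M.optimalInput (s t ω)‖ ^ 2) μ := fun t =>
    (((p.measurable_inputAt hp M hsw hD t).sub ((measurable_of_countable M.optimalInput).comp
      (hsw.measurable_state t))).norm.pow_const 2).aestronglyMeasurable
  obtain ⟨B, hB⟩ := p.exists_norm_inputAt_sub_le hp M √(n * ξ₁ ^ 2)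
  have hbound : ∀ t, ∀ᵐ ω ∂μ,
      ‖‖p.inputAt M (fun r => s r ω) (fun r => w r ω) (fun r => D r ω) t
        - M.optimalInput (s t ω)‖ ^ 2‖ ≤ B ^ 2 := fun t => by
    filter_upwards [hD.ae_forall_norm_le hν] with ω hω
    rw [norm_pow, norm_norm]
    exact pow_le_pow_left₀ (norm_nonneg _) (hB _ _ _ hω t _ (hopt _)) 2
  refine ⟨hlim, fun t => (integrable_const (B ^ 2)).mono' (hmeas t) (hbound t), ?_⟩
  simpa only [integral_zero] using tendsto_integral_of_dominated_convergence (fun _ => B ^ 2)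
    hmeas (integrable_const _) hbound hlim
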